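/- Let $n\ge 3$, let $C_{2^n}$ be the cyclic group of order $2^n$, and let $G=\mathrm{Hol}(C_{2^n})=C_{2^n}\rtimes\mathrm{Aut}(C_{2^n})$ be its holomorph. Let $a\in G$ be a generator of $N=C_{2^n}$, and let $b,c\in\mathrm{Aut}(C_{2^n})\le G$ be the elements with $b^{-1}ab=a^5$ and $c^{-1}ac=a^{-1}$; then $$G=\langle a,b,c\mid a^{2^n}=b^{2^{n-2}}=c^2=1,\ b^{-1}ab=a^5,\ c^{-1}ac=a^{-1},\ c^{-1}bc=b\rangle .$$ Fix a primitive $2^n$-th root of unity $\zeta\in\mathbb C$. The group $G$ acts on the linear characters of $N$ by $\chi^g(x)=\chi(g^{-1}xg)$. For $2\le k\le n$ let $\mathcal O_k$ be the orbit of the character $a\mapsto\zeta^{2^{n-k}}$, and say that an irreducible complex representation of $G$ corresponds to $\mathcal O_k$ if some character in $\mathcal O_k$ occurs in its restriction to $N$. Let $\phi$ be Euler's function. For $i\in\{0,1\}$, $\varepsilon\in\{1,-1\}$ and $\omega\in\mathbb C$ with $\omega^{2^{n-2}}=1$, let $\rho_{i,\omega,\varepsilon}$ be the representation of degree $1$ of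 $G$ with $$a\mapsto(-1)^i,\qquad b\mapsto\omega,\qquad c\mapsto\varepsilon .$$ For $2\le k\le n$ and $\omega\in\mathbb C$ with $\omega^{2^{n-k}}=1$, put $m=2^{k-2}$ and let $\rho_{k,\omega}$ be the matrix representation of $G$ of degree $2m$ with $$a\mapsto\begin{pmatrix}D&0\\0&D^{-1}\end{pmatrix},\qquad b\mapsto\begin{pmatrix}P_\omega&0\\0&P_\omega\end{pmatrix},\qquad c\mapsto\begin{pmatrix}0&I_m\\I_m&0\end{pmatrix},$$ where $D=\mathrm{diag}\bigl(\zeta^{5^j2^{n-k}}\bigr)_{0\le j<m}$ and $P_\omega$ is the $m\times m$ matrix with entries $1$ directly below the diagonal, $\omega$ in the upper right corner and $0$ elsewhere ($P_\omega=(\omega)$ if $m=1$). All these representations exist, and the following hold. 1. $G$ has exactly $2\phi(2^n)=2^n$ complex representations of degree $1$ up to equivalence. They are the $\rho_{0,\omega,\pm1}$ and $\rho_{1,\omega,\pm1}$, where $\omega$ runs over the $2^{n-2}$-th roots of unity, and these are pairwise inequivalent. 2. For $k=2,\dots,n$, up to equivalence, $G$ has exactly $2^{n-k}$ irreducible complex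 representations corresponding to $\mathcal O_k$. They are the $\rho_{k,\omega}$, where $\omega$ runs over the $2^{n-k}$-th roots of unity; these are irreducible, pairwise inequivalent and of degree $\phi(2^k)=2^{k-1}$. The number of equivalence classes of irreducible complex representations of $G$ of degree $\phi(2^k)$ is also $2^{n-k}$. 3. Up to equivalence, $G$ has exactly $(1+2+\cdots+2^n)-2^{n-1}$ irreducible complex representations, and each of them is equivalent to one of those listed in 1 and 2. 4. Up to equivalence, there is exactly one irreducible complex representation corresponding to $\mathcal O_n$, namely $\rho_{n,1}$. It has degree $\phi(2^n)$, it is faithful, and it is the unique faithful irreducible complex representation of $G$ up to equivalence. -/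

import Mathlib

universe u

namespace HolTwo

/-- The holomorph of a group: its semidirect product with its full automorphism group,
for the natural action. -/
abbrev Hol (K : Type*) [Group K] : Type _ := K ⋊[MonoidHom.id (MulAut K)] MulAut K

/-- The cyclic group of order `2 ^ n`, written multiplicatively. -/
abbrev Cyc (n : ℕ) : Type := Multiplicative (ZMod (2 ^ n))

/-- The standard generator of the cyclic group. -/
def gen (n : ℕ) : Cyc n := Multiplicative.ofAdd 1

lemma coprime_five (n : ℕ) : Nat.Coprime 5 (2 ^ n) :=
  Nat.Coprime.pow_right n (by norm_num)

/-- The automorphism `x ↦ x ^ 5` of the cyclic group of order `2 ^ n`. -/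
def powFive (n : ℕ) : MulAut (Cyc n) :=
  AddEquiv.toMultiplicative (AddAut.mulLeft (ZMod.unitOfCoprime 5 (coprime_five n)))

lemma powFive_apply (n : ℕ) (x : Cyc n) : powFive n x = x ^ 5 := by
  apply Multiplicative.toAdd.injective
  change ((5 : ℕ) : ZMod (2 ^ n)) * Multiplicative.toAdd x = 5 • Multiplicative.toAdd x
  rw [nsmul_eq_mul]

/-- The inversion automorphism `x ↦ x⁻¹` of the cyclic group of order `2 ^ n`. -/
def inversion (n : ℕ) : MulAut (Cyc n) := MulEquiv.inv (Cyc n)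

/-- The generator `a` of `Hol(C_{2^n})`. -/
def genA (n : ℕ) : Hol (Cyc n) := SemidirectProduct.inl (gen n)

/-- The generator `b`, normalised so that `b⁻¹ * a * b = a ^ 5`. -/
def genB (n : ℕ) : Hol (Cyc n) := (SemidirectProduct.inr (powFive n))⁻¹

/-- The generator `c`, acting on `a` by inversion. -/
def genC (n : ℕ) : Hol (Cyc n) := SemidirectProduct.inr (inversion n)

/-- Names of the three generators in the presentation. -/
inductive Gen : Type
  | a
  | b
  | c

/-- The relators of
`⟨a, b, c | a^(2^n) = b^(2^(n-2)) = c^2 = 1, b⁻¹ab = a^5, c⁻¹ac = a⁻¹, c⁻¹bc = b⟩`. -/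
def relators (n : ℕ) : Set (FreeGroup Gen) :=
  let x : FreeGroup Gen := FreeGroup.of Gen.a
  let y : FreeGroup Gen := FreeGroup.of Gen.b
  let z : FreeGroup Gen := FreeGroup.of Gen.c
  {x ^ (2 ^ n), y ^ (2 ^ (n - 2)), z ^ 2,
    y⁻¹ * x * y * (x ^ 5)⁻¹, z⁻¹ * x * z * (x⁻¹)⁻¹, z⁻¹ * y * z * y⁻¹}

/-- The conjugate `χ ^ g : x ↦ χ (g⁻¹ x g)` of a linear character of the normal subgroup
`C_{2^n}` by an element `g` of the holomorph; see `inl_conj`. -/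
def conjChar {n : ℕ} (χ : Cyc n →* ℂˣ) (g : Hol (Cyc n)) : Cyc n →* ℂˣ :=
  χ.comp (g.right⁻¹ : MulAut (Cyc n)).toMonoidHom

lemma inl_conj {n : ℕ} (g : Hol (Cyc n)) (x : Cyc n) :
    (SemidirectProduct.inl (g.right⁻¹ x) : Hol (Cyc n)) =
      g⁻¹ * SemidirectProduct.inl x * g := by
  ext1
  · simp only [SemidirectProduct.left_inl, SemidirectProduct.mul_left,
      SemidirectProduct.inv_left, SemidirectProduct.mul_right, SemidirectProduct.inv_right,
      SemidirectProduct.right_inl, MonoidHom.id_apply, mul_one, map_inv]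
    rw [mul_comm, ← mul_assoc, mul_inv_cancel, one_mul]
  · simp

/-- The orbit `O_k`, under conjugation, of the character `χ` of `C_{2^n}` whose value at the
generator is `ζ ^ (2 ^ (n - k))`. -/
def orbit (n : ℕ) (ζ : ℂ) (k : ℕ) : Set (Cyc n →* ℂˣ) :=
  {ψ | ∃ χ : Cyc n →* ℂˣ, (χ (gen n) : ℂ) = ζ ^ (2 ^ (n - k)) ∧
    ∃ g : Hol (Cyc n), ψ = conjChar χ g}

/-- A representation of the holomorph belongs to a set `O` of characters of `C_{2^n}` if some
member of `O` occurs in its restriction to `C_{2^n}`. -/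
def BelongsTo {n : ℕ} {V : Type*} [AddCommGroup V] [Module ℂ V]
    (ρ : Representation ℂ (Hol (Cyc n)) V) (O : Set (Cyc n →* ℂˣ)) : Prop :=
  ∃ ψ ∈ O, ∃ v : V, v ≠ 0 ∧
    ∀ x : Cyc n, ρ (SemidirectProduct.inl x) v = (ψ x : ℂ) • v

/-- Equivalence of representations. -/
def Equivalent {G V W : Type*} [Group G] [AddCommGroup V] [Module ℂ V] [AddCommGroup W]
    [Module ℂ W] (ρ : Representation ℂ G V) (σ : Representation ℂ G W) : Prop :=
  Nonempty (ρ.Equiv σ)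

/-- An irreducible complex representation on some `ℂ ^ d`. -/
structure Irrep (G : Type*) [Group G] where
  /-- the degree -/
  degree : ℕ
  /-- the underlying representation -/
  rep : Representation ℂ G (Fin degree → ℂ)
  irreducible : rep.IsIrreducible

/-- Equivalence of irreducible representations, as a setoid. -/
instance irrepSetoid (G : Type*) [Group G] : Setoid (Irrep G) where
  r ρ σ := Equivalent ρ.rep σ.rep
  iseqv :=
    { refl := fun ρ => ⟨Representation.Equiv.refl ρ.rep⟩
      symm := fun ⟨e⟩ => ⟨e.symm⟩
      trans := fun ⟨e⟩ ⟨f⟩ => ⟨e.trans f⟩ }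

/-- Equivalence classes of irreducible (finite-dimensional) complex representations. -/
def IrrClass (G : Type*) [Group G] : Type _ := Quotient (irrepSetoid G)

/-- `κ` is the equivalence class of the representation `ρ`. -/
def IrrClass.Contains {G V : Type*} [Group G] [AddCommGroup V] [Module ℂ V] (κ : IrrClass G)
    (ρ : Representation ℂ G V) : Prop :=
  ∃ σ : Irrep G, (Quotient.mk (irrepSetoid G) σ : IrrClass G) = κ ∧ Equivalent σ.rep ρ

/-- The degree of an equivalence class of irreducible representations. -/
def IrrClass.degree {G : Type*} [Group G] (κ : IrrClass G) : ℕ :=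
  Quotient.lift (s := irrepSetoid G) Irrep.degree (fun ρ σ ⟨e⟩ => by
    simpa using e.toLinearEquiv.finrank_eq) κ

/-- The equivalence class `κ` belongs to the set `O` of characters of `C_{2^n}`. -/
def IrrClass.BelongsTo {n : ℕ} (κ : IrrClass (Hol (Cyc n))) (O : Set (Cyc n →* ℂˣ)) : Prop :=
  ∃ σ : Irrep (Hol (Cyc n)),
    (Quotient.mk (irrepSetoid _) σ : IrrClass (Hol (Cyc n))) = κ ∧ HolTwo.BelongsTo σ.rep O

/-- Index set of a block: `ρ_{k,ω}` consists of `2 × 2` blocks of size `2 ^ (k - 2)`. -/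
abbrev Ix (k : ℕ) : Type := Fin (2 ^ (k - 2)) ⊕ Fin (2 ^ (k - 2))

/-- The diagonal matrix `ρ_{k,ω}(a)` with diagonal entries `ζ ^ (5 ^ j * 2 ^ (n - k))`, followed
by their inverses, `0 ≤ j < 2 ^ (k - 2)`. -/
noncomputable def matA (n k : ℕ) (ζ : ℂ) : Matrix (Ix k) (Ix k) ℂ :=
  Matrix.fromBlocks (Matrix.diagonal fun j => ζ ^ (5 ^ (j : ℕ) * 2 ^ (n - k))) 0
    0 (Matrix.diagonal fun j => (ζ ^ (5 ^ (j : ℕ) * 2 ^ (n - k)))⁻¹)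

/-- The `m × m` matrix with ones just below the diagonal, `ω` in the upper right corner and
zeros elsewhere (it is `(ω)` when `m = 1`). -/
def twistedCycle (m : ℕ) (ω : ℂ) : Matrix (Fin m) (Fin m) ℂ :=
  Matrix.of fun i j =>
    if (i : ℕ) = j + 1 then 1 else if (i : ℕ) = 0 ∧ (j : ℕ) + 1 = m then ω else 0

/-- The matrix `ρ_{k,ω}(b)`. -/
def matB (k : ℕ) (ω : ℂ) : Matrix (Ix k) (Ix k) ℂ :=
  Matrix.fromBlocks (twistedCycle (2 ^ (k - 2)) ω) 0 0 (twistedCycle (2 ^ (k - 2)) ω)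

/-- The matrix `ρ_{k,ω}(c)`. -/
def matC (k : ℕ) : Matrix (Ix k) (Ix k) ℂ := Matrix.fromBlocks 0 1 1 0

end HolTwo

open HolTwo

open HolTwo

/-! The units modulo `2 ^ k` are the residues `±5 ^ j`, and `5` has order `2 ^ (k - 2)`
(`five_pow_eq_iff`, `exists_five_pow`). Hence `b` and `c` generate the automorphism group, and every
element of the holomorph is some `c ^ l * b ^ j * a ^ i`. The same normal form follows from the
relations alone, and it is trivial in the holomorph only when the relations make it so; this proves
the presentation. A representation is therefore the same thing as three operators `A`, `B`, `C`
satisfying `HolRel`.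

In an irreducible representation take an eigenvector of `A`, with eigenvalue `μ`. Applying `B ^ j`
and `C` replaces `μ` by `μ ^ 5 ^ j` and `μ⁻¹`. If `μ = ±1`, the eigenspace is stable under the
commuting operators `B` and `C`, so there is a common eigenvector and the degree is one. Otherwise
some `ζ ^ 2 ^ (n - k)` with `2 ≤ k ≤ n` is an eigenvalue. Its eigenspace is stable under `B ^ 2 ^ (k
- 2)`, which has there an eigenvector `v` with eigenvalue `ω`. The vectors `B ^ j v` and `C (B ^ j
v)` then define a nonzero intertwining map from `ρ_{k,ω}`, and Schur's lemma finishes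
(`IsRho.equivalent`).

The models are irreducible because `A` has distinct eigenvalues on coordinate vectors that `B` and
`C` permute transitively up to scalars. The scalar `ω` is recovered from the action of `b ^ 2 ^ (k -
2)`. With `classification` these facts give all the counts, without characters or a sum of squares
of degrees. -/

namespace HolTwo

/-! ### Units modulo powers of two, and roots of unity -/

section Arithmetic

lemma five_pow_eq_iff {k : ℕ} (hk : 2 ≤ k) (i j : ℕ) :
    (5 : ZMod (2 ^ k)) ^ i = 5 ^ j ↔ i ≡ j [MOD 2 ^ (k - 2)] := by
  obtain ⟨k, rfl⟩ := Nat.exists_eq_add_of_le' hk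
  have h := ZMod.orderOf_five k
  have hf : IsOfFinOrder (5 : ZMod (2 ^ (k + 2))) := by
    rw [← orderOf_pos_iff, h]
    positivity
  rw [hf.pow_eq_pow_iff_modEq, h, Nat.add_sub_cancel]

lemma five_pow_eq_one {k : ℕ} (hk : 2 ≤ k) : (5 : ZMod (2 ^ k)) ^ 2 ^ (k - 2) = 1 := by
  rw [← pow_zero (5 : ZMod (2 ^ k)), five_pow_eq_iff hk]
  simp [Nat.ModEq]

/-- Modulo 4 the two sides are `1` and `-1`. -/
lemma five_pow_ne_neg {k : ℕ} (hk : 2 ≤ k) (i j : ℕ) :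
    (5 : ZMod (2 ^ k)) ^ i ≠ -5 ^ j := by
  intro h
  have h4 : 4 ∣ 2 ^ k := pow_dvd_pow 2 hk
  have := congrArg (ZMod.castHom h4 (ZMod 4)) h
  simp only [map_pow, map_neg, map_ofNat] at this
  rw [show (5 : ZMod 4) = 1 from rfl, one_pow, one_pow] at this
  exact absurd this (by decide)

/-- The `2 ^ (k - 2)` distinct powers of `5` and their negatives are `2 ^ (k - 1)` different units,
which is all of them. -/
lemma exists_five_pow {k : ℕ} (hk : 2 ≤ k) (u : (ZMod (2 ^ k))ˣ) :
    ∃ j : ℕ, (u : ZMod (2 ^ k)) = 5 ^ j ∨ (u : ZMod (2 ^ k)) = -5 ^ j := by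
  set v : (ZMod (2 ^ k))ˣ := ZMod.unitOfCoprime 5 (coprime_five k) with hv
  have hv5 : (v : ZMod (2 ^ k)) = 5 := by simp [hv]
  let f : Fin (2 ^ (k - 2)) × Bool → (ZMod (2 ^ k))ˣ :=
    fun p => if p.2 then v ^ (p.1 : ℕ) else -v ^ (p.1 : ℕ)
  have key (i j : Fin (2 ^ (k - 2))) (h : (5 : ZMod (2 ^ k)) ^ (i : ℕ) = 5 ^ (j : ℕ)) : i = j :=
    Fin.ext (((five_pow_eq_iff hk _ _).1 h).eq_of_lt_of_lt i.2 j.2)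
  have hinj : Function.Injective f := by
    rintro ⟨i, s⟩ ⟨j, t⟩ h
    have h' := congrArg (Units.val) h
    cases s <;> cases t <;> simp [f, hv5] at h'
    · rw [key i j h']
    · exact absurd h'.symm (five_pow_ne_neg hk _ _)
    · exact absurd h' (five_pow_ne_neg hk _ _)
    · rw [key i j h']
  have hcard : Fintype.card (Fin (2 ^ (k - 2)) × Bool) = Fintype.card (ZMod (2 ^ k))ˣ := by
    rw [ZMod.card_units_eq_totient, Nat.totient_prime_pow Nat.prime_two (by lia)]
    simp only [Fintype.card_prod, Fintype.card_fin, Fintype.card_bool]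
    rw [show k - 1 = (k - 2) + 1 by lia, pow_succ]
    simp
  obtain ⟨⟨j, s⟩, hj⟩ := ((Fintype.bijective_iff_injective_and_card f).2 ⟨hinj, hcard⟩).2 u
  refine ⟨j, ?_⟩
  rw [← hj]
  cases s <;> simp [f, hv5]

lemma pow_eq_pow_iff_cast {N : ℕ} {z : ℂ} (hz : IsPrimitiveRoot z N)
    (hN : N ≠ 0) (i j : ℕ) : z ^ i = z ^ j ↔ (i : ZMod N) = j := by
  have hf : IsOfFinOrder z := by
    rw [← orderOf_pos_iff, ← hz.eq_orderOf]
    exact Nat.pos_of_ne_zero hN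
  rw [hf.pow_eq_pow_iff_modEq, ← hz.eq_orderOf, ZMod.natCast_eq_natCast_iff]

lemma pow_eq_inv_pow_iff_cast {N : ℕ} {z : ℂ} (hz : IsPrimitiveRoot z N)
    (hN : N ≠ 0) (i j : ℕ) : z ^ i = (z ^ j)⁻¹ ↔ (i : ZMod N) = -j := by
  have h0 : z ^ j ≠ 0 := pow_ne_zero _ (hz.ne_zero hN)
  rw [← mul_eq_one_iff_eq_inv₀ h0, ← pow_add, ← pow_zero z, pow_eq_pow_iff_cast hz hN,
    eq_neg_iff_add_eq_zero]
  simp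

lemma isPrimitiveRoot_pow_two_pow {n k : ℕ} {ζ : ℂ} (hζ : IsPrimitiveRoot ζ (2 ^ n))
    (hk : k ≤ n) : IsPrimitiveRoot (ζ ^ 2 ^ (n - k)) (2 ^ k) :=
  hζ.pow (by positivity) (by rw [← pow_add]; congr 1; lia)

/-- A `2 ^ n`-th root of unity is either `±1`, or one of the numbers `ζ ^ (2 ^ (n - k))`
with `2 ≤ k ≤ n` is obtained from it by raising to a power `±5 ^ j`. -/
lemma sq_eq_one_or_exists_five_pow {n : ℕ} {ζ μ : ℂ} (hζ : IsPrimitiveRoot ζ (2 ^ n))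
    (hμ : μ ^ 2 ^ n = 1) :
    μ ^ 2 = 1 ∨ ∃ k, 2 ≤ k ∧ k ≤ n ∧ ∃ j : ℕ,
      μ ^ 5 ^ j = ζ ^ 2 ^ (n - k) ∨ μ ^ 5 ^ j = (ζ ^ 2 ^ (n - k))⁻¹ := by
  obtain ⟨k, hkn, hk⟩ := (Nat.dvd_prime_pow Nat.prime_two).1 (orderOf_dvd_of_pow_eq_one hμ)
  have hμk : IsPrimitiveRoot μ (2 ^ k) := hk ▸ IsPrimitiveRoot.orderOf μ
  rcases Nat.lt_or_ge k 2 with h2 | h2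
  · left
    rw [← orderOf_dvd_iff_pow_eq_one, hk]
    exact pow_dvd_pow 2 (show k ≤ 1 by lia)
  · refine Or.inr ⟨k, h2, hkn, ?_⟩
    have hl := isPrimitiveRoot_pow_two_pow hζ hkn
    -- Both `μ` and the target are primitive `2 ^ k`-th roots of unity, so they differ by an
    -- exponent prime to 2.
    obtain ⟨i, -, hi⟩ := hμk.eq_pow_of_pow_eq_one hl.pow_eq_one
    have hc : i.Coprime (2 ^ k) := by
      rw [← hμk.pow_iff_coprime (by positivity), hi]
      exact hl
    obtain ⟨j, hj⟩ := exists_five_pow h2 (ZMod.unitOfCoprime i hc)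
    refine ⟨j, hj.imp (fun h => ?_) (fun h => ?_)⟩
    · rw [← hi, pow_eq_pow_iff_cast hμk (by positivity)]
      simpa using h.symm
    · rw [← hi, pow_eq_inv_pow_iff_cast hμk (by positivity)]
      rw [ZMod.coe_unitOfCoprime] at h
      rw [h]
      simp

end Arithmetic

/-! ### Consequences of the defining relations in a monoid -/

section Relations

/-- The defining relations of the holomorph, in a form which makes sense in any monoid. -/
structure HolRel {M : Type*} [Monoid M] (n : ℕ) (a b c : M) : Prop where
  pow_a : a ^ 2 ^ n = 1
  pow_b : b ^ 2 ^ (n - 2) = 1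
  pow_c : c ^ 2 = 1
  a_mul_b : a * b = b * a ^ 5
  a_mul_c_mul_a : a * c * a = c
  c_mul_b : c * b = b * c

namespace HolRel

variable {M : Type*} [Monoid M] {n : ℕ} {a b c : M}

lemma pow_a_mul_b (h : HolRel n a b c) (i : ℕ) : a ^ i * b = b * a ^ (5 * i) := by
  rw [pow_mul]
  exact (SemiconjBy.pow_right (show SemiconjBy b (a ^ 5) a from h.a_mul_b.symm) i).symm

lemma a_mul_pow_b (h : HolRel n a b c) (j : ℕ) : a * b ^ j = b ^ j * a ^ 5 ^ j := by
  induction j with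
  | zero => simp
  | succ j ih => rw [pow_succ, ← mul_assoc, ih, mul_assoc, h.pow_a_mul_b, ← mul_assoc, pow_succ']

/-- A monoid has no `a⁻¹`; the power `a ^ (2 ^ n - 1)` takes its place. -/
lemma a_mul_c (h : HolRel n a b c) : a * c = c * a ^ (2 ^ n - 1) := by
  calc a * c = a * c * (a * a ^ (2 ^ n - 1)) := by
        rw [mul_pow_sub_one (by positivity), h.pow_a, mul_one]
    _ = c * a ^ (2 ^ n - 1) := by rw [← mul_assoc, h.a_mul_c_mul_a]

lemma map (h : HolRel n a b c) {M' : Type*} [Monoid M'] (f : M →* M') :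
    HolRel n (f a) (f b) (f c) where
  pow_a := by rw [← map_pow, h.pow_a, map_one]
  pow_b := by rw [← map_pow, h.pow_b, map_one]
  pow_c := by rw [← map_pow, h.pow_c, map_one]
  a_mul_b := by rw [← map_mul, h.a_mul_b, map_mul, map_pow]
  a_mul_c_mul_a := by rw [← map_mul, ← map_mul, h.a_mul_c_mul_a]
  c_mul_b := by rw [← map_mul, h.c_mul_b, map_mul]

end HolRel

/-- The submonoid generated by elements satisfying the relations consists of normal forms. -/
lemma HolRel.exists_normalForm {M : Type*} [Monoid M] {n : ℕ} {a b c : M} (h : HolRel n a b c)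
    {x : M} (hx : x ∈ Submonoid.closure {a, b, c}) :
    ∃ l j i : ℕ, x = c ^ l * b ^ j * a ^ i := by
  induction hx using Submonoid.closure_induction_left with
  | one => exact ⟨0, 0, 0, by simp⟩
  | mul_left y hy z _ ih =>
    obtain ⟨l, j, i, rfl⟩ := ih
    rcases hy with rfl | rfl | rfl
    -- The factor `y`, which is `a`, is moved to the right through the powers of `c` and then of
    -- `b`; each passage only changes its exponent.
    · have key : ∀ l : ℕ, ∃ s : ℕ, y * c ^ l = c ^ l * y ^ s := by
        intro l
        induction l with
        | zero => exact ⟨1, by simp⟩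
        | succ l ih =>
          obtain ⟨s, hs⟩ := ih
          refine ⟨(2 ^ n - 1) * s, ?_⟩
          rw [pow_succ, ← mul_assoc, hs, mul_assoc, pow_mul,
            (SemiconjBy.pow_right (show SemiconjBy c (y ^ (2 ^ n - 1)) y from
              h.a_mul_c.symm) s).symm, mul_assoc]
      obtain ⟨s, hs⟩ := key l
      have hb : ∀ s : ℕ, y ^ s * b ^ j = b ^ j * y ^ (5 ^ j * s) := fun s => by
        rw [pow_mul]
        exact (SemiconjBy.pow_right (show SemiconjBy (b ^ j) (y ^ 5 ^ j) y from
          (h.a_mul_pow_b j).symm) s).symm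
      refine ⟨l, j, 5 ^ j * s + i, ?_⟩
      rw [pow_add, ← mul_assoc, ← mul_assoc, ← mul_assoc, hs, mul_assoc (c ^ l) (y ^ s), hb,
        ← mul_assoc]
    · refine ⟨l, j + 1, i, ?_⟩
      have : Commute y (c ^ l) := Commute.pow_right h.c_mul_b.symm l
      rw [← mul_assoc, ← mul_assoc, this.eq, mul_assoc (c ^ l), pow_succ' y]
    · exact ⟨l + 1, j, i, by rw [pow_succ', mul_assoc, mul_assoc, mul_assoc]⟩

end Relations

/-! ### Generators and normal forms in the holomorph -/

section Holomorph

variable {n : ℕ}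

lemma gen_pow (i : ℕ) : gen n ^ i = Multiplicative.ofAdd (i : ZMod (2 ^ n)) := by
  rw [gen, ← ofAdd_nsmul, nsmul_one]

lemma exists_gen_pow (x : Cyc n) : ∃ i : ℕ, x = gen n ^ i :=
  ⟨(Multiplicative.toAdd x).val, by rw [gen_pow, ZMod.natCast_rightInverse]; rfl⟩

lemma gen_pow_eq_one_iff (i : ℕ) : gen n ^ i = 1 ↔ 2 ^ n ∣ i := by
  rw [gen_pow, ← ZMod.natCast_eq_zero_iff]
  rfl

lemma mulAut_ext {φ ψ : MulAut (Cyc n)} (h : φ (gen n) = ψ (gen n)) : φ = ψ := by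
  refine MulEquiv.ext fun x => ?_
  obtain ⟨i, rfl⟩ := exists_gen_pow x
  rw [map_pow, map_pow, h]

lemma powFive_pow_gen (j : ℕ) : (powFive n ^ j) (gen n) = gen n ^ 5 ^ j := by
  induction j with
  | zero => simp
  | succ j ih => rw [pow_succ', MulAut.mul_apply, ih, powFive_apply, ← pow_mul, pow_succ]

lemma genA_pow (i : ℕ) : genA n ^ i = SemidirectProduct.inl (gen n ^ i) := by
  rw [genA, map_pow]

lemma powFive_pow_eq_one (hn : 2 ≤ n) : powFive n ^ 2 ^ (n - 2) = 1 := by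
  apply mulAut_ext
  rw [powFive_pow_gen, gen_pow]
  push_cast
  rw [five_pow_eq_one hn]
  rfl

lemma holRel (hn : 2 ≤ n) : HolRel n (genA n) (genB n) (genC n) where
  pow_a := by
    rw [genA_pow, (gen_pow_eq_one_iff _).2 dvd_rfl, map_one]
  pow_b := by
    rw [genB, inv_pow, ← map_pow, powFive_pow_eq_one hn, map_one, inv_one]
  pow_c := by
    rw [genC, ← map_pow, show inversion n ^ 2 = 1 from ?_, map_one]
    ext x
    simp [inversion, sq]
  a_mul_b := by
    have h := inl_conj (genB n) (gen n)
    have h1 : (genB n).right⁻¹ (gen n) = gen n ^ 5 := by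
      rw [← powFive_apply, genB]
      simp
    rw [h1] at h
    rw [genA_pow, h, genA]
    group
  a_mul_c_mul_a := by
    have h := inl_conj (genC n) (gen n)
    have h1 : (genC n).right⁻¹ (gen n) = (gen n)⁻¹ := by
      rw [genC]
      simp only [SemidirectProduct.right_inr]
      rw [MulAut.inv_apply, MulEquiv.symm_apply_eq]
      simp [inversion]
    rw [h1, map_inv, ← genA, eq_comm, ← mul_eq_one_iff_eq_inv] at h
    rw [← mul_right_inj (genC n)⁻¹, inv_mul_cancel, ← h]
    group
  c_mul_b := by
    have : Commute (inversion n) (powFive n) := by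
      ext x
      simp [inversion, powFive_apply]
    exact (this.map (SemidirectProduct.inr : _ →* Hol (Cyc n))).inv_right

lemma closure_gens (hn : 2 ≤ n) :
    Subgroup.closure ({genA n, genB n, genC n} : Set (Hol (Cyc n))) = ⊤ := by
  rw [eq_top_iff]
  rintro g -
  have hA : genA n ∈ Subgroup.closure ({genA n, genB n, genC n} : Set (Hol (Cyc n))) :=
    Subgroup.subset_closure (by simp)
  have hB : genB n ∈ Subgroup.closure ({genA n, genB n, genC n} : Set (Hol (Cyc n))) :=
    Subgroup.subset_closure (by simp)
  have hC : genC n ∈ Subgroup.closure ({genA n, genB n, genC n} : Set (Hol (Cyc n))) :=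
    Subgroup.subset_closure (by simp)
  rw [← SemidirectProduct.inl_left_mul_inr_right g]
  refine mul_mem ?_ ?_
  · obtain ⟨i, hi⟩ := exists_gen_pow g.left
    rw [hi, ← genA_pow]
    exact pow_mem hA i
  · set φ := g.right
    -- An automorphism of a cyclic group is multiplication by a residue; the inverse automorphism
    -- supplies the inverse residue.
    have hu : IsUnit (Multiplicative.toAdd (φ (gen n))) := by
      obtain ⟨i, hi⟩ := exists_gen_pow (φ.symm (gen n))
      obtain ⟨j, hj⟩ := exists_gen_pow (φ (gen n))
      have h1 : gen n ^ (j * i) = gen n := by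
        rw [pow_mul, ← hj, ← map_pow, ← hi, MulEquiv.apply_symm_apply]
      rw [gen_pow] at h1
      have h2 : ((j : ZMod (2 ^ n)) * i) = 1 := by
        exact_mod_cast congrArg Multiplicative.toAdd h1
      rw [hj, gen_pow]
      exact IsUnit.of_mul_eq_one _ h2
    obtain ⟨u, hu⟩ := hu
    obtain ⟨j, hj | hj⟩ := exists_five_pow hn u
    · have : φ = powFive n ^ j := by
        apply mulAut_ext
        rw [powFive_pow_gen, gen_pow]
        push_cast
        rw [← hj, hu]
        rfl
      rw [this, map_pow]
      refine pow_mem ?_ j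
      rw [← inv_inv (SemidirectProduct.inr (powFive n))]
      exact inv_mem hB
    · have : φ = inversion n * powFive n ^ j := by
        apply mulAut_ext
        rw [MulAut.mul_apply, powFive_pow_gen, gen_pow]
        push_cast
        change _ = (Multiplicative.ofAdd _)⁻¹
        rw [← ofAdd_neg, ← hj, hu]
        rfl
      rw [this, map_mul, map_pow]
      refine mul_mem hC (pow_mem ?_ j)
      rw [← inv_inv (SemidirectProduct.inr (powFive n))]
      exact inv_mem hB

instance : Finite (Hol (Cyc n)) :=
  Finite.of_equiv _ SemidirectProduct.equivProd.symm

lemma exists_normalForm (hn : 2 ≤ n) (g : Hol (Cyc n)) :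
    ∃ l j i : ℕ, g = genC n ^ l * genB n ^ j * genA n ^ i := by
  apply (holRel hn).exists_normalForm
  have h := congrArg Subgroup.toSubmonoid (closure_gens hn)
  -- In a finite group the generators already generate as a monoid, so no inverses occur.
  rw [Subgroup.closure_toSubmonoid_of_finite] at h
  rw [h]
  trivial

end Holomorph

/-! ### The presentation and its universal property -/

section Presentation

variable {n : ℕ}

/-- The assignment of three given elements to the three generators. -/
def genVal {M : Type*} (a b c : M) : Gen → M
  | Gen.a => a
  | Gen.b => b
  | Gen.c => c

lemma HolRel.lift_relators {G : Type*} [Group G] {a b c : G} (h : HolRel n a b c) :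
    ∀ r ∈ relators n, FreeGroup.lift (genVal a b c) r = 1 := by
  rintro r (rfl | rfl | rfl | rfl | rfl | rfl)
  · simpa [genVal] using h.pow_a
  · simpa [genVal] using h.pow_b
  · simpa [genVal] using h.pow_c
  · simp only [genVal, map_mul, map_inv, map_pow, FreeGroup.lift_apply_of]
    rw [mul_assoc b⁻¹, h.a_mul_b, inv_mul_cancel_left, mul_inv_cancel]
  · simp only [genVal, map_mul, map_inv, FreeGroup.lift_apply_of, inv_inv]
    rw [mul_assoc c⁻¹, mul_assoc c⁻¹, h.a_mul_c_mul_a, inv_mul_cancel]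
  · simp only [genVal, map_mul, map_inv, FreeGroup.lift_apply_of]
    rw [mul_assoc c⁻¹, ← h.c_mul_b, inv_mul_cancel_left, mul_inv_cancel]

lemma holRel_of_relators {G : Type*} [Group G] (f : FreeGroup Gen →* G)
    (hf : ∀ r ∈ relators n, f r = 1) :
    HolRel n (f (FreeGroup.of Gen.a)) (f (FreeGroup.of Gen.b)) (f (FreeGroup.of Gen.c)) := by
  simp only [relators, Set.mem_insert_iff, Set.mem_singleton_iff, forall_eq_or_imp,
    forall_eq, map_mul, map_pow, map_inv, inv_inv] at hf
  obtain ⟨h1, h2, h3, h4, h5, h6⟩ := hf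
  refine ⟨h1, h2, h3, ?_, ?_, ?_⟩
  · rwa [mul_inv_eq_one, mul_assoc, inv_mul_eq_iff_eq_mul] at h4
  · rw [mul_assoc, mul_assoc, inv_mul_eq_one] at h5
    rw [mul_assoc, ← h5]
  · rw [mul_inv_eq_one, mul_assoc, inv_mul_eq_iff_eq_mul] at h6
    exact h6.symm

lemma holRel_presented : HolRel n (PresentedGroup.of Gen.a : PresentedGroup (relators n))
    (PresentedGroup.of Gen.b) (PresentedGroup.of Gen.c) :=
  holRel_of_relators (PresentedGroup.mk (relators n)) fun _ => PresentedGroup.one_of_mem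

lemma exists_normalForm_presented (x : PresentedGroup (relators n)) :
    ∃ l j i : ℕ, x = PresentedGroup.of Gen.c ^ l * PresentedGroup.of Gen.b ^ j *
      PresentedGroup.of Gen.a ^ i := by
  have hr := holRel_presented (n := n)
  apply hr.exists_normalForm
  have hs : Set.range (PresentedGroup.of : Gen → PresentedGroup (relators n)) =
      {PresentedGroup.of Gen.a, PresentedGroup.of Gen.b, PresentedGroup.of Gen.c} := by
    ext y
    simp only [Set.mem_range, Set.mem_insert_iff, Set.mem_singleton_iff]
    constructor
    · rintro ⟨_ | _ | _, rfl⟩ <;> simp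
    · rintro (rfl | rfl | rfl) <;> exact ⟨_, rfl⟩
  have h := congrArg Subgroup.toSubmonoid (PresentedGroup.closure_range_of (relators n))
  -- Finiteness of the presented group is not yet known, but generators of finite order suffice to
  -- dispense with inverses.
  rw [hs, Subgroup.closure_toSubmonoid_of_isOfFinOrder] at h
  · rw [h]
    trivial
  · rintro y (rfl | rfl | rfl)
    · exact isOfFinOrder_iff_pow_eq_one.2 ⟨_, by positivity, hr.pow_a⟩
    · exact isOfFinOrder_iff_pow_eq_one.2 ⟨_, by positivity, hr.pow_b⟩
    · exact isOfFinOrder_iff_pow_eq_one.2 ⟨_, by positivity, hr.pow_c⟩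

/-- Projecting to the automorphism group gives `(-1) ^ l = 5 ^ j` modulo `2 ^ n`. This forces `l` to
be even, and then the order of `5` divides `j`. -/
lemma normalForm_eq_one (hn : 2 ≤ n) {l j i : ℕ}
    (h : genC n ^ l * genB n ^ j * genA n ^ i = 1) :
    2 ∣ l ∧ 2 ^ (n - 2) ∣ j ∧ 2 ^ n ∣ i := by
  have hr := congrArg SemidirectProduct.rightHom h
  simp only [genA, genB, genC, map_mul, map_pow, map_inv, map_one,
    SemidirectProduct.rightHom_inl, SemidirectProduct.rightHom_inr, one_pow, mul_one,
    inv_pow, mul_inv_eq_one] at hr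
  have hg := congrArg (fun φ : MulAut (Cyc n) => φ (gen n)) hr
  simp only [powFive_pow_gen] at hg
  have hinv2 : inversion n ^ 2 = 1 := by
    ext x
    simp [inversion, sq]
  have hl : 2 ∣ l := by
    by_contra hl
    obtain ⟨t, rfl⟩ := Nat.odd_iff.2 (Nat.two_dvd_ne_zero.1 hl)
    rw [pow_succ, pow_mul, hinv2, one_pow, one_mul, gen_pow] at hg
    have : -(1 : ZMod (2 ^ n)) = ((5 ^ j : ℕ) : ZMod (2 ^ n)) := congrArg Multiplicative.toAdd hg
    push_cast at this
    exact five_pow_ne_neg hn j 0 (by rw [← this, pow_zero])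
  have hc : genC n ^ l = 1 := by
    obtain ⟨t, rfl⟩ := hl
    rw [pow_mul, (holRel hn).pow_c, one_pow]
  have hj : 2 ^ (n - 2) ∣ j := by
    obtain ⟨t, rfl⟩ := hl
    rw [pow_mul, hinv2, one_pow, gen_pow] at hg
    have : (1 : ZMod (2 ^ n)) = ((5 ^ j : ℕ) : ZMod (2 ^ n)) := congrArg Multiplicative.toAdd hg
    push_cast at this
    rw [← pow_zero (5 : ZMod (2 ^ n)), five_pow_eq_iff hn] at this
    exact (Nat.modEq_zero_iff_dvd).1 this.symm
  refine ⟨hl, hj, ?_⟩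
  have hb : genB n ^ j = 1 := by
    obtain ⟨t, rfl⟩ := hj
    rw [pow_mul, (holRel hn).pow_b, one_pow]
  rw [hc, hb, one_mul, one_mul, genA_pow, ← map_one SemidirectProduct.inl,
    SemidirectProduct.inl_inj] at h
  exact (gen_pow_eq_one_iff i).1 h

/-- The homomorphism from the abstractly presented group to the holomorph. -/
def presentedToHol (hn : 2 ≤ n) : PresentedGroup (relators n) →* Hol (Cyc n) :=
  PresentedGroup.toGroup (holRel hn).lift_relators

lemma presentedToHol_bijective (hn : 2 ≤ n) : Function.Bijective (presentedToHol hn) := by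
  have hof (x : Gen) : presentedToHol hn (PresentedGroup.of x) =
      genVal (genA n) (genB n) (genC n) x := PresentedGroup.toGroup.of _
  constructor
  · rw [injective_iff_map_eq_one]
    intro x hx
    obtain ⟨l, j, i, rfl⟩ := exists_normalForm_presented x
    simp only [map_mul, map_pow, hof, genVal] at hx
    obtain ⟨⟨l, rfl⟩, ⟨j, rfl⟩, ⟨i, rfl⟩⟩ := normalForm_eq_one hn hx
    have hr := holRel_presented (n := n)
    simp only [pow_mul, hr.pow_a, hr.pow_b, hr.pow_c, one_pow, mul_one]
  · intro g
    obtain ⟨l, j, i, rfl⟩ := exists_normalForm hn g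
    exact ⟨PresentedGroup.of Gen.c ^ l * PresentedGroup.of Gen.b ^ j *
      PresentedGroup.of Gen.a ^ i, by simp only [map_mul, map_pow, hof, genVal]⟩

/-- The presentation of the holomorph. -/
noncomputable def presentation (hn : 2 ≤ n) : PresentedGroup (relators n) ≃* Hol (Cyc n) :=
  MulEquiv.ofBijective (presentedToHol hn) (presentedToHol_bijective hn)

lemma presentation_of (hn : 2 ≤ n) (x : Gen) : presentation hn (PresentedGroup.of x) =
    genVal (genA n) (genB n) (genC n) x :=
  PresentedGroup.toGroup.of (holRel hn).lift_relators

/-- Elements of a monoid satisfying the relations define a homomorphism from the holomorph. -/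
lemma HolRel.exists_hom (hn : 2 ≤ n) {M : Type*} [Monoid M] {a b c : M} (h : HolRel n a b c) :
    ∃ f : Hol (Cyc n) →* M, f (genA n) = a ∧ f (genB n) = b ∧ f (genC n) = c := by
  -- The power relations make the three elements invertible, so the universal property applies in
  -- the group of units.
  let a' : Mˣ := Units.ofPowEqOne a _ h.pow_a (by positivity)
  let b' : Mˣ := Units.ofPowEqOne b _ h.pow_b (by positivity)
  let c' : Mˣ := Units.ofPowEqOne c _ h.pow_c (by positivity)
  have h' : HolRel n a' b' c' := by
    constructor <;> apply Units.ext <;> simp [a', b', c', h.a_mul_b, h.a_mul_c_mul_a, h.c_mul_b]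
  let F : Hol (Cyc n) →* Mˣ :=
    (PresentedGroup.toGroup h'.lift_relators).comp (presentation hn).symm.toMonoidHom
  have hF (x : Gen) : F (genVal (genA n) (genB n) (genC n) x) = genVal a' b' c' x := by
    rw [← presentation_of hn x]
    simp [F]
  refine ⟨(Units.coeHom M).comp F, ?_, ?_, ?_⟩
  · simpa [a', genVal] using congrArg Units.val (hF Gen.a)
  · simpa [b', genVal] using congrArg Units.val (hF Gen.b)
  · simpa [c', genVal] using congrArg Units.val (hF Gen.c)

end Presentation

/-! ### Reduction of statements to the three generators -/

section HolInduction

variable {n : ℕ}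

lemma hol_induction (hn : 2 ≤ n) {p : Hol (Cyc n) → Prop} (one : p 1)
    (mul : ∀ g h, p g → p h → p (g * h)) (a : p (genA n)) (b : p (genB n)) (c : p (genC n))
    (g : Hol (Cyc n)) : p g := by
  have hpow {x : Hol (Cyc n)} (hx : p x) (i : ℕ) : p (x ^ i) := by
    induction i with
    | zero => simpa using one
    | succ i ih => rw [pow_succ]; exact mul _ _ ih hx
  obtain ⟨l, j, i, rfl⟩ := exists_normalForm hn g
  exact mul _ _ (mul _ _ (hpow c l) (hpow b j)) (hpow a i)

variable {V W : Type*} [AddCommGroup V] [Module ℂ V] [AddCommGroup W] [Module ℂ W]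

lemma comp_eq_comp_of_gens (hn : 2 ≤ n) (ρ : Representation ℂ (Hol (Cyc n)) V)
    (σ : Representation ℂ (Hol (Cyc n)) W) (T : V →ₗ[ℂ] W)
    (ha : T ∘ₗ ρ (genA n) = σ (genA n) ∘ₗ T) (hb : T ∘ₗ ρ (genB n) = σ (genB n) ∘ₗ T)
    (hc : T ∘ₗ ρ (genC n) = σ (genC n) ∘ₗ T) (g : Hol (Cyc n)) :
    T ∘ₗ ρ g = σ g ∘ₗ T := by
  refine hol_induction hn (p := fun g => T ∘ₗ ρ g = σ g ∘ₗ T) (by ext; simp) ?_ ha hb hc g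
  intro g h hg hh
  rw [map_mul, map_mul, Module.End.mul_eq_comp, Module.End.mul_eq_comp, ← LinearMap.comp_assoc,
    hg, LinearMap.comp_assoc, hh, LinearMap.comp_assoc]

end HolInduction

/-! ### Irreducibility and Schur's lemma -/

section Irreducibility

variable {G V : Type*} [Group G] [AddCommGroup V] [Module ℂ V] {ρ : Representation ℂ G V}

lemma isIrreducible_of_forall [Nontrivial V]
    (h : ∀ U : Submodule ℂ V, (∀ g, ∀ v ∈ U, ρ g v ∈ U) → U ≠ ⊥ → U = ⊤) :
    ρ.IsIrreducible where
  exists_pair_ne := ⟨⊥, ⊤, fun e => bot_ne_top (α := Submodule ℂ V)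
    (congrArg Subrepresentation.toSubmodule e)⟩
  eq_bot_or_eq_top U := by
    by_cases hU : U.toSubmodule = ⊥
    · exact Or.inl (Subrepresentation.toSubmodule_injective hU)
    · exact Or.inr (Subrepresentation.toSubmodule_injective
        (h _ (fun g v hv => U.apply_mem_toSubmodule g hv) hU))

lemma eq_top_of_isIrreducible (hρ : ρ.IsIrreducible) {U : Submodule ℂ V}
    (hU : ∀ g, ∀ v ∈ U, ρ g v ∈ U) {v : V} (hv : v ∈ U) (hv0 : v ≠ 0) : U = ⊤ := by
  rcases hρ.eq_bot_or_eq_top ⟨U, fun g v hv => hU g v hv⟩ with h | h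
  · have : U = ⊥ := congrArg Subrepresentation.toSubmodule h
    rw [this, Submodule.mem_bot] at hv
    exact absurd hv hv0
  · exact congrArg Subrepresentation.toSubmodule h

lemma nontrivial_of_isIrreducible (hρ : ρ.IsIrreducible) : Nontrivial V := by
  by_contra h
  rw [not_nontrivial_iff_subsingleton] at h
  obtain ⟨x, y, hxy⟩ := hρ.exists_pair_ne
  exact hxy (Subrepresentation.toSubmodule_injective (Subsingleton.elim _ _))

/-- The orbit of a nonzero vector is finite and spans an invariant subspace. -/
lemma finiteDimensional_of_isIrreducible [Finite G] (hρ : ρ.IsIrreducible) :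
    FiniteDimensional ℂ V := by
  have := nontrivial_of_isIrreducible hρ
  obtain ⟨v, hv⟩ := exists_ne (0 : V)
  have h : Submodule.span ℂ (Set.range fun g => ρ g v) = ⊤ := by
    refine eq_top_of_isIrreducible hρ (fun g w hw => ?_)
      (v := v) (Submodule.subset_span (Set.mem_range.2 ⟨1, by simp⟩)) hv
    induction hw using Submodule.span_induction with
    | mem x hx =>
      obtain ⟨h, rfl⟩ := hx
      exact Submodule.subset_span ⟨g * h, by simp⟩
    | zero => simp
    | add x y _ _ hx hy => rw [map_add]; exact add_mem hx hy
    | smul c x _ hx => rw [map_smul]; exact Submodule.smul_mem _ _ hx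
  exact Module.finite_def.2 (h ▸ Submodule.fg_span (Set.finite_range _))

/-- Schur's lemma. The equivalence is reversed because `T` will run from an explicit model to a
given representation. -/
lemma equivalent_of_intertwining {W : Type*} [AddCommGroup W] [Module ℂ W]
    {σ : Representation ℂ G W} (hρ : ρ.IsIrreducible) (hσ : σ.IsIrreducible) (T : V →ₗ[ℂ] W)
    (hT : ∀ g, T ∘ₗ ρ g = σ g ∘ₗ T) (h0 : T ≠ 0) : Equivalent σ ρ := by
  let f : Representation.IntertwiningMap ρ σ := ⟨T, hT⟩
  rcases Representation.IsIrreducible.bijective_or_eq_zero f with h | h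
  · exact ⟨(f.ofBijective h).symm⟩
  · exact absurd (congrArg Representation.IntertwiningMap.toLinearMap h) h0

lemma exists_eigenvector_mem [FiniteDimensional ℂ V] (f : Module.End ℂ V) (U : Submodule ℂ V)
    (hf : ∀ v ∈ U, f v ∈ U) {u : V} (hu : u ∈ U) (hu0 : u ≠ 0) :
    ∃ v ∈ U, v ≠ 0 ∧ ∃ μ : ℂ, f v = μ • v := by
  have : Nontrivial U := ⟨⟨u, hu⟩, 0, fun h => hu0 (congrArg Subtype.val h)⟩
  obtain ⟨μ, hμ⟩ := Module.End.exists_eigenvalue (f.restrict hf)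
  obtain ⟨v, hv⟩ := hμ.exists_hasEigenvector
  exact ⟨v, v.2, fun h => hv.2 (Subtype.ext h), μ, congrArg Subtype.val hv.apply_eq_smul⟩

/-- An invariant subspace of a diagonal operator with distinct eigenvalues contains each
coordinate vector on which it does not vanish identically. -/
lemma single_mem_of_diagonal {ι : Type*} [Fintype ι] [DecidableEq ι] {d : ι → ℂ}
    (hd : Function.Injective d) (U : Submodule ℂ (ι → ℂ))
    (hU : ∀ w ∈ U, (fun i => d i * w i) ∈ U) {w : ι → ℂ} (hw : w ∈ U) {x : ι} (hx : w x ≠ 0) :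
    (Pi.single x 1 : ι → ℂ) ∈ U := by
  have key (S : Finset ι) (hS : x ∉ S) : ∃ u ∈ U, u x ≠ 0 ∧ ∀ y ∈ S, u y = 0 := by
    induction S using Finset.induction_on with
    | empty => exact ⟨w, hw, hx, by simp⟩
    | insert y S _ ih =>
      rw [Finset.mem_insert, not_or] at hS
      obtain ⟨u, hu, hux, huS⟩ := ih hS.2
      -- The operator minus `d y` kills coordinate `y` and multiplies coordinate `x` by `d x - d y ≠
      -- 0`.
      refine ⟨(fun i => d i * u i) - d y • u, sub_mem (hU u hu) (U.smul_mem _ hu), ?_, ?_⟩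
      · simp only [Pi.sub_apply, Pi.smul_apply, smul_eq_mul, ← sub_mul]
        exact mul_ne_zero (sub_ne_zero.2 (hd.ne hS.1)) hux
      · intro z hz
        rcases Finset.mem_insert.1 hz with rfl | hz
        · simp
        · simp [huS z hz]
  obtain ⟨u, hu, hux, hu0⟩ := key (Finset.univ.erase x) (by simp)
  have : (Pi.single x 1 : ι → ℂ) = (u x)⁻¹ • u := by
    ext y
    by_cases hy : y = x
    · subst hy
      simp [hux]
    · simp [hy, hu0 y (by simp [hy])]
  rw [this]
  exact U.smul_mem _ hu

end Irreducibility

/-! ### The matrices of `ρ_{k,ω}` acting on their basis -/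

section MonomialBasis

variable {n k : ℕ} {ζ ω : ℂ}

/-- The index of the `j`-th vector in the first (`true`) or second (`false`) block. -/
def ix {k : ℕ} (s : Bool) (j : Fin (2 ^ (k - 2))) : Ix k := cond s (Sum.inl j) (Sum.inr j)

lemma exists_ix (x : Ix k) : ∃ s j, x = ix s j := by
  rcases x with j | j
  · exact ⟨true, j, rfl⟩
  · exact ⟨false, j, rfl⟩

/-- The basis vectors of the representation space, extended to all natural indices so that
`matB` acts as the shift. -/
noncomputable def cycVec (k : ℕ) (ω : ℂ) (s : Bool) (j : ℕ) : Ix k → ℂ :=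
  ω ^ (j / 2 ^ (k - 2)) • Pi.single (ix s ⟨j % 2 ^ (k - 2), Nat.mod_lt _ (by positivity)⟩) 1

lemma cycVec_of_lt (s : Bool) (j : Fin (2 ^ (k - 2))) :
    cycVec k ω s j = Pi.single (ix s j) 1 := by
  simp [cycVec, Nat.div_eq_of_lt j.2, Nat.mod_eq_of_lt j.2]

/-- The corner entry `ω` of the twisted cycle becomes this quasi-periodicity: one full turn
multiplies by `ω`. -/
lemma cycVec_add_mul (s : Bool) (j q : ℕ) :
    cycVec k ω s (j + 2 ^ (k - 2) * q) = ω ^ q • cycVec k ω s j := by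
  have hm : 0 < 2 ^ (k - 2) := by positivity
  simp only [cycVec, Nat.add_mul_div_left _ _ hm, Nat.add_mul_mod_self_left, smul_smul, pow_add]
  rw [mul_comm]

lemma cycVec_eq_smul (s : Bool) (j : ℕ) : cycVec k ω s j =
    ω ^ (j / 2 ^ (k - 2)) • cycVec k ω s (j % 2 ^ (k - 2)) := by
  rw [← cycVec_add_mul, Nat.mod_add_div]

lemma cycVec_zero_ne_zero : cycVec k ω true 0 ≠ 0 := by
  intro h
  have h0 := cycVec_of_lt (k := k) (ω := ω) true ⟨0, by positivity⟩
  rw [h] at h0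
  exact one_ne_zero (Pi.single_eq_zero_iff.1 h0.symm)

/-- Testing on all natural indices avoids a separate case for the wrap-around of the cycle. -/
lemma linearMap_ext_cycVec {W : Type*} [AddCommGroup W] [Module ℂ W] (ω : ℂ)
    {f g : (Ix k → ℂ) →ₗ[ℂ] W} (h : ∀ s j, f (cycVec k ω s j) = g (cycVec k ω s j)) : f = g := by
  refine LinearMap.pi_ext' fun x => LinearMap.ext_ring ?_
  obtain ⟨s, j, rfl⟩ := exists_ix x
  simpa [cycVec_of_lt] using h s j

lemma eq_top_of_cycVec_mem (U : Submodule ℂ (Ix k → ℂ)) (h : ∀ s j, cycVec k ω s j ∈ U) :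
    U = ⊤ := by
  rw [eq_top_iff]
  intro w _
  rw [pi_eq_sum_univ' w]
  refine sum_mem fun x _ => U.smul_mem _ ?_
  obtain ⟨s, j, rfl⟩ := exists_ix x
  have := h s j
  rw [cycVec_of_lt] at this
  convert this using 1

/-- The eigenvalues of `matA` on the vectors `cycVec`. -/
noncomputable def eigA (n k : ℕ) (ζ : ℂ) (s : Bool) (j : ℕ) : ℂ :=
  cond s (ζ ^ 2 ^ (n - k)) (ζ ^ 2 ^ (n - k))⁻¹ ^ 5 ^ j

lemma eigA_succ (s : Bool) (j : ℕ) : eigA n k ζ s (j + 1) = eigA n k ζ s j ^ 5 := by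
  rw [eigA, eigA, ← pow_mul, pow_succ]

lemma matA_eq_diagonal : matA n k ζ = Matrix.diagonal
    (Sum.elim (fun j : Fin (2 ^ (k - 2)) => eigA n k ζ true j)
      (fun j : Fin (2 ^ (k - 2)) => eigA n k ζ false j)) := by
  rw [matA, Matrix.fromBlocks_diagonal]
  congr 1
  ext (j | j)
  · simp [eigA, ← pow_mul, mul_comm]
  · simp [eigA, ← pow_mul, mul_comm]

lemma eigA_pow_eq_one (hζ : IsPrimitiveRoot ζ (2 ^ n)) (hkn : k ≤ n) (s : Bool) (j : ℕ) :
    eigA n k ζ s j ^ 2 ^ k = 1 := by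
  have h := (isPrimitiveRoot_pow_two_pow hζ hkn).pow_eq_one
  cases s <;> simp only [eigA, cond_true, cond_false, inv_pow]
  · rw [← pow_mul, mul_comm, pow_mul, h, one_pow, inv_one]
  · rw [← pow_mul, mul_comm, pow_mul, h, one_pow]

lemma eigA_mod (hζ : IsPrimitiveRoot ζ (2 ^ n)) (hk : 2 ≤ k) (hkn : k ≤ n) (s : Bool) (j : ℕ) :
    eigA n k ζ s (j % 2 ^ (k - 2)) = eigA n k ζ s j := by
  have h := isPrimitiveRoot_pow_two_pow hζ hkn
  have : (ζ ^ 2 ^ (n - k)) ^ 5 ^ (j % 2 ^ (k - 2)) = (ζ ^ 2 ^ (n - k)) ^ 5 ^ j := by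
    rw [pow_eq_pow_iff_cast h (by positivity)]
    push_cast
    rw [five_pow_eq_iff hk]
    exact Nat.mod_modEq _ _
  cases s <;> simp [eigA, this]

/-- The exponents `±5 ^ j` with `j < 2 ^ (k - 2)` are distinct modulo `2 ^ k`. -/
lemma eigA_injective (hζ : IsPrimitiveRoot ζ (2 ^ n)) (hk : 2 ≤ k) (hkn : k ≤ n) :
    Function.Injective (Sum.elim (fun j : Fin (2 ^ (k - 2)) => eigA n k ζ true j)
      (fun j : Fin (2 ^ (k - 2)) => eigA n k ζ false j)) := by
  have h := isPrimitiveRoot_pow_two_pow hζ hkn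
  have h1 (i j : Fin (2 ^ (k - 2)))
      (e : (ζ ^ 2 ^ (n - k)) ^ 5 ^ (i : ℕ) = (ζ ^ 2 ^ (n - k)) ^ 5 ^ (j : ℕ)) : i = j := by
    rw [pow_eq_pow_iff_cast h (by positivity)] at e
    push_cast at e
    rw [five_pow_eq_iff hk] at e
    exact Fin.ext (e.eq_of_lt_of_lt i.2 j.2)
  have h2 (i j : ℕ) : (ζ ^ 2 ^ (n - k)) ^ 5 ^ i ≠ ((ζ ^ 2 ^ (n - k)) ^ 5 ^ j)⁻¹ := by
    rw [Ne, pow_eq_inv_pow_iff_cast h (by positivity)]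
    push_cast
    exact five_pow_ne_neg hk i j
  rintro (i | i) (j | j) e <;>
    simp only [Sum.elim_inl, Sum.elim_inr, eigA, cond_true, cond_false, inv_pow, inv_inj] at e
  · rw [h1 i j e]
  · exact absurd e (h2 _ _)
  · exact absurd e.symm (h2 _ _)
  · rw [h1 i j e]

lemma matA_cycVec (hζ : IsPrimitiveRoot ζ (2 ^ n)) (hk : 2 ≤ k) (hkn : k ≤ n) (s : Bool) (j : ℕ) :
    Matrix.toLin' (matA n k ζ) (cycVec k ω s j) = eigA n k ζ s j • cycVec k ω s j := by
  rw [cycVec, map_smul, smul_comm]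
  congr 1
  rw [matA_eq_diagonal, Matrix.toLin'_apply, ← eigA_mod hζ hk hkn s j]
  ext y
  rw [Matrix.mulVec_diagonal]
  cases s <;> rcases y with y | y <;> simp [ix, Pi.single_apply] <;>
    split_ifs with h <;> simp [h]

lemma matB_cycVec (s : Bool) (j : ℕ) :
    Matrix.toLin' (matB k ω) (cycVec k ω s j) = cycVec k ω s (j + 1) := by
  have key (i : Fin (2 ^ (k - 2))) :
      Matrix.toLin' (matB k ω) (cycVec k ω s i) = cycVec k ω s (i + 1) := by
    rw [cycVec_of_lt, Matrix.toLin'_apply, Matrix.mulVec_single_one]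
    rcases Nat.lt_or_ge (i + 1 : ℕ) (2 ^ (k - 2)) with hi | hi
    · rw [cycVec_of_lt s ⟨i + 1, hi⟩]
      ext y
      have h1 : ¬ ((i : ℕ) + 1 = 2 ^ (k - 2)) := hi.ne
      cases s <;> rcases y with y | y <;>
        simp [ix, matB, twistedCycle, Pi.single_apply, Fin.ext_iff, h1, -Fin.val_eq_zero_iff]
    -- The last column: the shift returns to index `0` with the factor `ω`.
    · have hi' : (i : ℕ) + 1 = 2 ^ (k - 2) := le_antisymm i.2 hi
      have h0 : (i : ℕ) + 1 = ((⟨0, by positivity⟩ : Fin (2 ^ (k - 2))) : ℕ) + 2 ^ (k - 2) * 1 := by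
        simp [hi']
      rw [h0, cycVec_add_mul, cycVec_of_lt, pow_one]
      ext y
      have h1 (y : Fin (2 ^ (k - 2))) : ¬ ((y : ℕ) = i + 1) := by
        rw [hi']
        exact y.2.ne
      cases s <;> rcases y with y | y <;>
        simp [ix, matB, twistedCycle, Pi.single_apply, Fin.ext_iff, h1,
          -Fin.val_eq_zero_iff] <;> simp [hi']
  have hm : 0 < 2 ^ (k - 2) := by positivity
  rw [cycVec_eq_smul, map_smul, key ⟨j % 2 ^ (k - 2), Nat.mod_lt _ hm⟩, ← cycVec_add_mul]
  congr 1
  have := Nat.mod_add_div j (2 ^ (k - 2))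
  simp only
  lia

lemma matC_cycVec (s : Bool) (j : ℕ) :
    Matrix.toLin' (matC k) (cycVec k ω s j) = cycVec k ω (!s) j := by
  rw [cycVec, map_smul, cycVec, Matrix.toLin'_apply, Matrix.mulVec_single_one]
  congr 1
  ext y
  cases s <;> rcases y with y | y <;> simp [ix, matC, Pi.single_apply, Matrix.one_apply]

lemma matB_pow_cycVec (s : Bool) (j t : ℕ) :
    (Matrix.toLin' (matB k ω) ^ t) (cycVec k ω s j) = cycVec k ω s (j + t) := by
  induction t with
  | zero => simp
  | succ t ih => rw [pow_succ', Module.End.mul_apply, ih, matB_cycVec, add_assoc]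

lemma matA_pow_cycVec (hζ : IsPrimitiveRoot ζ (2 ^ n)) (hk : 2 ≤ k) (hkn : k ≤ n) (s : Bool)
    (j t : ℕ) : (Matrix.toLin' (matA n k ζ) ^ t) (cycVec k ω s j) =
      eigA n k ζ s j ^ t • cycVec k ω s j := by
  induction t with
  | zero => simp
  | succ t ih => rw [pow_succ', Module.End.mul_apply, ih, map_smul, matA_cycVec hζ hk hkn,
      smul_smul, pow_succ]

/-- The condition on `ω` enters through `b`: since `n - 2 = (k - 2) + (n - k)`, the power `B ^ 2 ^
(n - 2)` makes `2 ^ (n - k)` full turns and is the scalar `ω ^ 2 ^ (n - k)`. -/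
lemma holRel_mat (hζ : IsPrimitiveRoot ζ (2 ^ n)) (hk : 2 ≤ k) (hkn : k ≤ n)
    (hω : ω ^ 2 ^ (n - k) = 1) : HolRel n (Matrix.toLin' (matA n k ζ))
      (Matrix.toLin' (matB k ω)) (Matrix.toLin' (matC k)) where
  pow_a := linearMap_ext_cycVec ω fun s j => by
    rw [matA_pow_cycVec hζ hk hkn, ← Nat.add_sub_cancel' hkn, pow_add, pow_mul,
      Nat.add_sub_cancel' hkn, eigA_pow_eq_one hζ hkn, one_pow, one_smul, Module.End.one_apply]
  pow_b := linearMap_ext_cycVec ω fun s j => by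
    rw [matB_pow_cycVec, show n - 2 = (k - 2) + (n - k) by lia, pow_add, cycVec_add_mul, hω,
      one_smul, Module.End.one_apply]
  pow_c := linearMap_ext_cycVec ω fun s j => by
    rw [sq, Module.End.mul_apply, matC_cycVec, matC_cycVec, Bool.not_not, Module.End.one_apply]
  a_mul_b := linearMap_ext_cycVec ω fun s j => by
    rw [Module.End.mul_apply, Module.End.mul_apply, matB_cycVec, matA_cycVec hζ hk hkn,
      matA_pow_cycVec hζ hk hkn, map_smul, matB_cycVec, eigA_succ]
  a_mul_c_mul_a := linearMap_ext_cycVec ω fun s j => by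
    have h0 : ζ ≠ 0 := hζ.ne_zero (by positivity)
    have : eigA n k ζ s j * eigA n k ζ (!s) j = 1 := by
      rw [eigA, eigA, ← mul_pow]
      cases s <;> simp [h0]
    rw [Module.End.mul_apply, Module.End.mul_apply, matA_cycVec hζ hk hkn, map_smul, map_smul,
      matC_cycVec, matA_cycVec hζ hk hkn, smul_smul, this, one_smul]
  c_mul_b := linearMap_ext_cycVec ω fun s j => by
    rw [Module.End.mul_apply, Module.End.mul_apply, matB_cycVec, matC_cycVec, matC_cycVec,
      matB_cycVec]

end MonomialBasis

/-! ### How `B` and `C` move the eigenvectors of `A` -/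

section Eigenvectors

variable {V : Type*} [AddCommGroup V] [Module ℂ V] {n : ℕ} {A B C : Module.End ℂ V}

lemma pow_apply_of_eigen {f : Module.End ℂ V} {v : V} {μ : ℂ} (h : f v = μ • v) (t : ℕ) :
    (f ^ t) v = μ ^ t • v := by
  induction t with
  | zero => simp
  | succ t ih => rw [pow_succ', Module.End.mul_apply, ih, map_smul, h, smul_smul, pow_succ]

lemma eigenvalue_pow_eq_one {f : Module.End ℂ V} {v : V} (hv : v ≠ 0) {μ : ℂ} (h : f v = μ • v)
    {t : ℕ} (ht : f ^ t = 1) : μ ^ t = 1 := by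
  have := pow_apply_of_eigen h t
  rw [ht, Module.End.one_apply] at this
  exact smul_left_injective ℂ hv (by simpa using this.symm)

namespace HolRel

lemma apply_pow_b (h : HolRel n A B C) {v : V} {μ : ℂ} (hv : A v = μ • v) (j : ℕ) :
    A ((B ^ j) v) = μ ^ 5 ^ j • (B ^ j) v := by
  rw [← Module.End.mul_apply, h.a_mul_pow_b, Module.End.mul_apply, pow_apply_of_eigen hv,
    map_smul]

lemma apply_c (h : HolRel n A B C) {v : V} {μ : ℂ} (hμ : μ ≠ 0) (hv : A v = μ • v) :
    A (C v) = μ⁻¹ • C v := by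
  have := congrArg (fun f : Module.End ℂ V => f v) h.a_mul_c_mul_a
  simp only [Module.End.mul_apply, hv, map_smul] at this
  rw [eq_inv_smul_iff₀ hμ, this]

lemma c_apply_c (h : HolRel n A B C) (v : V) : C (C v) = v := by
  rw [← Module.End.mul_apply, ← sq, h.pow_c, Module.End.one_apply]

lemma pow_b_apply_ne_zero (h : HolRel n A B C) {v : V} (hv : v ≠ 0) (j : ℕ) :
    (B ^ j) v ≠ 0 := by
  intro h0
  have : (B ^ 2 ^ (n - 2)) ^ j = 1 := by rw [h.pow_b, one_pow]
  have h1 := congrArg (fun f : Module.End ℂ V => f v) this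
  simp only [Module.End.one_apply] at h1
  rw [← pow_mul, mul_comm, pow_mul, show 2 ^ (n - 2) = (2 ^ (n - 2) - 1) + 1 by
    have : 0 < 2 ^ (n - 2) := by positivity
    lia, pow_succ, Module.End.mul_apply, h0, map_zero] at h1
  exact hv h1.symm

lemma c_apply_ne_zero (h : HolRel n A B C) {v : V} (hv : v ≠ 0) : C v ≠ 0 := by
  intro h0
  have := h.c_apply_c v
  rw [h0, map_zero] at this
  exact hv this.symm

end HolRel

/-- Either there is a common eigenvector of `A`, `B`, `C`, or one of the numbers
`ζ ^ (2 ^ (n - k))` with `2 ≤ k ≤ n` is an eigenvalue of `A`. -/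
lemma HolRel.exists_eigenvector [FiniteDimensional ℂ V] [Nontrivial V] (h : HolRel n A B C)
    {ζ : ℂ} (hζ : IsPrimitiveRoot ζ (2 ^ n)) :
    (∃ v : V, v ≠ 0 ∧ ∃ α β γ : ℂ, A v = α • v ∧ B v = β • v ∧ C v = γ • v) ∨
    ∃ k, 2 ≤ k ∧ k ≤ n ∧ ∃ v : V, v ≠ 0 ∧ A v = ζ ^ 2 ^ (n - k) • v := by
  obtain ⟨μ, hμ⟩ := Module.End.exists_eigenvalue A
  obtain ⟨v, hv⟩ := hμ.exists_hasEigenvector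
  have hv0 := hv.2
  have hAv := hv.apply_eq_smul
  have hμn := eigenvalue_pow_eq_one hv0 hAv h.pow_a
  have hμ0 : μ ≠ 0 := fun h0 => by
    rw [h0, zero_pow (by positivity)] at hμn
    exact zero_ne_one hμn
  rcases sq_eq_one_or_exists_five_pow hζ hμn with h2 | ⟨k, hk, hkn, j, hj⟩
  · left
    -- For `μ = ±1` both `μ ^ 5` and `μ⁻¹` equal `μ`, so the eigenspace is stable under `B` and `C`.
    have h5 : μ ^ 5 = μ := by
      rw [show 5 = 2 * 2 + 1 by rfl, pow_succ, pow_mul, h2, one_pow, one_mul]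
    have hinv : μ⁻¹ = μ := inv_eq_of_mul_eq_one_left (by rw [← sq, h2])
    obtain ⟨w, hw, hw0, β, hβ⟩ := exists_eigenvector_mem B (Module.End.eigenspace A μ)
      (fun u hu => by
        rw [Module.End.mem_eigenspace_iff] at hu ⊢
        simpa [h5] using h.apply_pow_b hu 1) (Module.End.mem_eigenspace_iff.2 hAv) hv0
    obtain ⟨u, hu, hu0, γ, hγ⟩ := exists_eigenvector_mem C
      (Module.End.eigenspace A μ ⊓ Module.End.eigenspace B β)
      (fun u hu => by
        rw [Submodule.mem_inf, Module.End.mem_eigenspace_iff, Module.End.mem_eigenspace_iff]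
          at hu ⊢
        refine ⟨?_, ?_⟩
        · simpa [hinv] using h.apply_c hμ0 hu.1
        · rw [← Module.End.mul_apply, ← h.c_mul_b, Module.End.mul_apply, hu.2, map_smul])
      ⟨hw, Module.End.mem_eigenspace_iff.2 hβ⟩ hw0
    rw [Submodule.mem_inf, Module.End.mem_eigenspace_iff, Module.End.mem_eigenspace_iff] at hu
    exact ⟨u, hu0, μ, β, γ, hu.1, hu.2, hγ⟩
  · right
    refine ⟨k, hk, hkn, ?_⟩
    have hb := h.apply_pow_b hAv j
    have hb0 := h.pow_b_apply_ne_zero hv0 j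
    -- The sign in `±5 ^ j` decides whether `C` must be applied after `B ^ j`.
    rcases hj with hj | hj
    · exact ⟨_, hb0, hj ▸ hb⟩
    · refine ⟨_, h.c_apply_ne_zero hb0, ?_⟩
      have hc := h.apply_c (pow_ne_zero _ hμ0) hb
      rwa [hj, inv_inv] at hc

end Eigenvectors

/-! ### Representations of degree one -/

section Linear

variable {n : ℕ}

lemma isIrreducible_of_finrank_eq_one {G V : Type*} [Group G] [AddCommGroup V] [Module ℂ V]
    (ρ : Representation ℂ G V) (h : Module.finrank ℂ V = 1) : ρ.IsIrreducible := by
  have := Module.nontrivial_of_finrank_pos (R := ℂ) (M := V) (by lia)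
  have hs : IsSimpleModule ℂ V := isSimpleModule_iff_finrank_eq_one.2 h
  exact isIrreducible_of_forall fun U _ hU => (eq_bot_or_eq_top U).resolve_left hU

/-- `ρ` is the representation of degree one with the given values on the generators. -/
structure IsLin (n : ℕ) (α β γ : ℂ) (ρ : Representation ℂ (Hol (Cyc n)) ℂ) : Prop where
  apply_a : ρ (genA n) = α • LinearMap.id
  apply_b : ρ (genB n) = β • LinearMap.id
  apply_c : ρ (genC n) = γ • LinearMap.id

lemma exists_isLin (hn : 2 ≤ n) {α β γ : ℂ} (hα : α ^ 2 = 1) (hβ : β ^ 2 ^ (n - 2) = 1)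
    (hγ : γ ^ 2 = 1) : ∃ ρ, IsLin n α β γ ρ := by
  -- The relations are checked among complex numbers and carried over to scalar endomorphisms.
  have h : HolRel n α β γ :=
    { pow_a := by
        rw [show n = 1 + (n - 1) by lia, pow_add, pow_mul, pow_one, hα, one_pow]
      pow_b := hβ
      pow_c := hγ
      a_mul_b := by linear_combination -β * α * (α ^ 2 + 1) * hα
      a_mul_c_mul_a := by linear_combination γ * hα
      c_mul_b := mul_comm _ _ }
  obtain ⟨ρ, ha, hb, hc⟩ := (h.map (algebraMap ℂ (Module.End ℂ ℂ)).toMonoidHom).exists_hom hn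
  exact ⟨ρ, ha, hb, hc⟩

lemma IsLin.isIrreducible {α β γ : ℂ} {ρ : Representation ℂ (Hol (Cyc n)) ℂ}
    (_ : IsLin n α β γ ρ) : ρ.IsIrreducible :=
  isIrreducible_of_finrank_eq_one ρ (Module.finrank_self ℂ)

/-- A scalar action is an invariant of the equivalence class; it separates the members of both
families. -/
lemma equivalent_apply_smul {G V W : Type*} [Group G] [AddCommGroup V] [Module ℂ V]
    [AddCommGroup W] [Module ℂ W] [Nontrivial V] {ρ : Representation ℂ G V}
    {σ : Representation ℂ G W} (h : Equivalent ρ σ) {g : G} {α β : ℂ}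
    (hρ : ∀ v, ρ g v = α • v) (hσ : ∀ w, σ g w = β • w) : α = β := by
  obtain ⟨e⟩ := h
  obtain ⟨v, hv⟩ := exists_ne (0 : V)
  have h1 := Representation.IntertwiningMap.isIntertwining ρ σ e.toIntertwiningMap g v
  rw [hρ, hσ, map_smul] at h1
  have h2 : e.toIntertwiningMap v ≠ 0 := fun h0 => hv (e.toLinearEquiv.map_eq_zero_iff.1 h0)
  exact smul_left_injective ℂ h2 h1

lemma IsLin.eq_of_equivalent {α β γ α' β' γ' : ℂ} {ρ ρ' : Representation ℂ (Hol (Cyc n)) ℂ}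
    (h : IsLin n α β γ ρ) (h' : IsLin n α' β' γ' ρ') (e : Equivalent ρ ρ') :
    α = α' ∧ β = β' ∧ γ = γ' :=
  ⟨equivalent_apply_smul e (g := genA n) (fun v => by simp [h.apply_a])
      (fun v => by simp [h'.apply_a]),
    equivalent_apply_smul e (g := genB n) (fun v => by simp [h.apply_b])
      (fun v => by simp [h'.apply_b]),
    equivalent_apply_smul e (g := genC n) (fun v => by simp [h.apply_c])
      (fun v => by simp [h'.apply_c])⟩

variable {V : Type*} [AddCommGroup V] [Module ℂ V]

/-- For scalars the relation `a * c * a = c` reads `α ^ 2 * γ = γ`, and `γ` is invertible. -/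
lemma HolRel.scalar_relations {A B C : Module.End ℂ V} (h : HolRel n A B C) {v : V} (hv : v ≠ 0)
    {α β γ : ℂ} (ha : A v = α • v) (hb : B v = β • v) (hc : C v = γ • v) :
    α ^ 2 = 1 ∧ β ^ 2 ^ (n - 2) = 1 ∧ γ ^ 2 = 1 := by
  have hγ := eigenvalue_pow_eq_one hv hc h.pow_c
  refine ⟨?_, eigenvalue_pow_eq_one hv hb h.pow_b, hγ⟩
  have h1 := congrArg (fun f : Module.End ℂ V => f v) h.a_mul_c_mul_a
  simp only [Module.End.mul_apply, ha, hc, map_smul, smul_smul] at h1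
  have h2 : α * (γ * α) = γ := smul_left_injective ℂ hv h1
  linear_combination γ * h2 + (1 - α ^ 2) * hγ

lemma IsLin.equivalent (hn : 2 ≤ n) {α β γ : ℂ} {ρ : Representation ℂ (Hol (Cyc n)) ℂ}
    (hρ : IsLin n α β γ ρ) {σ : Representation ℂ (Hol (Cyc n)) V} (hσ : σ.IsIrreducible)
    {v : V} (hv : v ≠ 0) (ha : σ (genA n) v = α • v) (hb : σ (genB n) v = β • v)
    (hc : σ (genC n) v = γ • v) : Equivalent σ ρ := by
  refine equivalent_of_intertwining hρ.isIrreducible hσ (LinearMap.toSpanSingleton ℂ V v)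
    (comp_eq_comp_of_gens hn ρ σ _ ?_ ?_ ?_) ?_
  · ext
    simp [hρ.apply_a, ha]
  · ext
    simp [hρ.apply_b, hb]
  · ext
    simp [hρ.apply_c, hc]
  · rwa [Ne, LinearMap.toSpanSingleton_eq_zero_iff]

end Linear

/-! ### The representations `ρ_{k,ω}` -/

section Monomial

variable {n k : ℕ} {ζ ω : ℂ}

/-- `ρ` is the monomial representation with the given matrices on the generators. -/
structure IsRho (n k : ℕ) (ζ ω : ℂ) (ρ : Representation ℂ (Hol (Cyc n)) (Ix k → ℂ)) : Prop where
  apply_a : ρ (genA n) = Matrix.toLin' (matA n k ζ)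
  apply_b : ρ (genB n) = Matrix.toLin' (matB k ω)
  apply_c : ρ (genC n) = Matrix.toLin' (matC k)

lemma exists_isRho (hζ : IsPrimitiveRoot ζ (2 ^ n)) (hk : 2 ≤ k) (hkn : k ≤ n)
    (hω : ω ^ 2 ^ (n - k) = 1) : ∃ ρ, IsRho n k ζ ω ρ := by
  obtain ⟨ρ, ha, hb, hc⟩ := (holRel_mat hζ hk hkn hω).exists_hom (hk.trans hkn)
  exact ⟨ρ, ha, hb, hc⟩

namespace IsRho

variable {ρ : Representation ℂ (Hol (Cyc n)) (Ix k → ℂ)}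

/-- A nonzero invariant subspace contains a coordinate vector, as `A` has distinct eigenvalues. Then
`B` yields its whole block, and `C` the other one. -/
lemma isIrreducible (hρ : IsRho n k ζ ω ρ) (hζ : IsPrimitiveRoot ζ (2 ^ n)) (hk : 2 ≤ k)
    (hkn : k ≤ n) (hω : ω ≠ 0) : ρ.IsIrreducible := by
  have : Nontrivial (Ix k → ℂ) := ⟨_, 0, cycVec_zero_ne_zero (ω := ω)⟩
  refine isIrreducible_of_forall fun U hU hU0 => eq_top_of_cycVec_mem (ω := ω) U ?_
  obtain ⟨w, hw, hw0⟩ := U.exists_mem_ne_zero_of_ne_bot hU0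
  obtain ⟨x, hx⟩ := Function.ne_iff.1 hw0
  have hmem : (Pi.single x 1 : Ix k → ℂ) ∈ U := by
    refine single_mem_of_diagonal (eigA_injective hζ hk hkn) U (fun u hu => ?_) hw hx
    have := hU (genA n) u hu
    rw [hρ.apply_a, matA_eq_diagonal, Matrix.toLin'_apply] at this
    convert this using 1
    ext y
    rw [Matrix.mulVec_diagonal]
  obtain ⟨s, i, rfl⟩ := exists_ix x
  rw [← cycVec_of_lt (ω := ω)] at hmem
  have hB (s : Bool) (j : ℕ) (hj : cycVec k ω s j ∈ U) (t : ℕ) : cycVec k ω s (j + t) ∈ U := by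
    rw [← matB_pow_cycVec, ← hρ.apply_b, ← map_pow]
    exact hU _ _ hj
  have hall (j : ℕ) : cycVec k ω s j ∈ U := by
    -- The shift only raises indices, so vector `j` is reached after `i` extra turns, with the
    -- factor `ω ^ i ≠ 0`.
    have h1 := hB s i hmem (j + 2 ^ (k - 2) * i - i)
    have hle : (i : ℕ) ≤ 2 ^ (k - 2) * i := Nat.le_mul_of_pos_left _ (by positivity)
    rw [show (i : ℕ) + (j + 2 ^ (k - 2) * i - i) = j + 2 ^ (k - 2) * i from
      Nat.add_sub_cancel' (le_add_left hle), cycVec_add_mul] at h1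
    exact (U.smul_mem_iff (pow_ne_zero _ hω)).1 h1
  intro s' j
  by_cases hs : s' = s
  · exact hs ▸ hall j
  · have h1 := hU (genC n) _ (hall j)
    rw [hρ.apply_c, matC_cycVec] at h1
    rwa [show s' = !s by cases s <;> cases s' <;> simp_all]

lemma apply_pow_b (hρ : IsRho n k ζ ω ρ) (v : Ix k → ℂ) :
    ρ (genB n ^ 2 ^ (k - 2)) v = ω • v := by
  have : ρ (genB n ^ 2 ^ (k - 2)) = ω • LinearMap.id := by
    refine linearMap_ext_cycVec ω fun s j => ?_
    rw [map_pow, hρ.apply_b, matB_pow_cycVec, ← mul_one (2 ^ (k - 2)), cycVec_add_mul, pow_one]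
    rfl
  rw [this]
  rfl

lemma eq_of_equivalent {ω' : ℂ} {ρ' : Representation ℂ (Hol (Cyc n)) (Ix k → ℂ)}
    (hρ : IsRho n k ζ ω ρ) (hρ' : IsRho n k ζ ω' ρ') (e : Equivalent ρ ρ') : ω = ω' := by
  have : Nontrivial (Ix k → ℂ) := ⟨_, 0, cycVec_zero_ne_zero (ω := ω)⟩
  exact equivalent_apply_smul e hρ.apply_pow_b hρ'.apply_pow_b

lemma apply_a_cycVec (hρ : IsRho n k ζ ω ρ) (hζ : IsPrimitiveRoot ζ (2 ^ n)) (hk : 2 ≤ k)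
    (hkn : k ≤ n) : ρ (genA n) (cycVec k ω true 0) = ζ ^ 2 ^ (n - k) • cycVec k ω true 0 := by
  rw [hρ.apply_a, matA_cycVec hζ hk hkn]
  simp [eigA]

lemma apply_pow_a (hρ : IsRho n k ζ ω ρ) (hζ : IsPrimitiveRoot ζ (2 ^ n)) (hk : 2 ≤ k)
    (hkn : k ≤ n) : ρ (genA n ^ 2 ^ k) = 1 := by
  refine linearMap_ext_cycVec ω fun s j => ?_
  rw [map_pow, hρ.apply_a, matA_pow_cycVec hζ hk hkn, eigA_pow_eq_one hζ hkn, one_smul,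
    Module.End.one_apply]

variable {V : Type*} [AddCommGroup V] [Module ℂ V]

/-- The map `T` sends the `j`-th basis vectors of the two blocks to `B ^ j v` and `C (B ^ j v)`. By
`hb` this formula persists for all natural `j`, and on such vectors intertwining follows from the
relations. -/
lemma equivalent (hρ : IsRho n k ζ ω ρ) (hζ : IsPrimitiveRoot ζ (2 ^ n)) (hk : 2 ≤ k)
    (hkn : k ≤ n) (hω : ω ≠ 0) {σ : Representation ℂ (Hol (Cyc n)) V} (hσ : σ.IsIrreducible)
    {v : V} (hv : v ≠ 0) (ha : σ (genA n) v = ζ ^ 2 ^ (n - k) • v)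
    (hb : (σ (genB n) ^ 2 ^ (k - 2)) v = ω • v) : Equivalent σ ρ := by
  have hn : 2 ≤ n := hk.trans hkn
  have hr := (holRel hn).map σ
  have hl0 : ζ ^ 2 ^ (n - k) ≠ 0 := pow_ne_zero _ (hζ.ne_zero (by positivity))
  let T : (Ix k → ℂ) →ₗ[ℂ] V := (Pi.basisFun ℂ (Ix k)).constr ℂ
    (Sum.elim (fun j => (σ (genB n) ^ (j : ℕ)) v)
      (fun j => σ (genC n) ((σ (genB n) ^ (j : ℕ)) v)))
  have hT1 (s : Bool) (j : Fin (2 ^ (k - 2))) : T (cycVec k ω s j) =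
      cond s LinearMap.id (σ (genC n)) ((σ (genB n) ^ (j : ℕ)) v) := by
    rw [cycVec_of_lt, ← Pi.basisFun_apply, Module.Basis.constr_basis]
    cases s <;> simp [ix]
  have hT (s : Bool) (j : ℕ) : T (cycVec k ω s j) =
      cond s LinearMap.id (σ (genC n)) ((σ (genB n) ^ j) v) := by
    have hm : j % 2 ^ (k - 2) < 2 ^ (k - 2) := Nat.mod_lt _ (by positivity)
    rw [cycVec_eq_smul, map_smul, hT1 s ⟨_, hm⟩, ← map_smul, ← map_smul,
      ← pow_apply_of_eigen hb, ← pow_mul]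
    congr 1
    rw [← Module.End.mul_apply, ← pow_add, Nat.mod_add_div]
  have hcb (j : ℕ) : σ (genB n) (σ (genC n) ((σ (genB n) ^ j) v)) =
      σ (genC n) ((σ (genB n) ^ (j + 1)) v) := by
    rw [← Module.End.mul_apply, ← hr.c_mul_b, Module.End.mul_apply, pow_succ',
      Module.End.mul_apply]
  refine equivalent_of_intertwining (hρ.isIrreducible hζ hk hkn hω) hσ T
    (comp_eq_comp_of_gens hn ρ σ T ?_ ?_ ?_) ?_
  · refine linearMap_ext_cycVec ω fun s j => ?_
    rw [LinearMap.comp_apply, LinearMap.comp_apply, hρ.apply_a, matA_cycVec hζ hk hkn, map_smul,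
      hT]
    cases s
    · simp only [cond_false, eigA]
      rw [hr.apply_c (pow_ne_zero _ hl0) (hr.apply_pow_b ha j), inv_pow]
    · simp only [cond_true, eigA, LinearMap.id_apply]
      rw [hr.apply_pow_b ha j]
  · refine linearMap_ext_cycVec ω fun s j => ?_
    rw [LinearMap.comp_apply, LinearMap.comp_apply, hρ.apply_b, matB_cycVec, hT, hT]
    cases s
    · simp only [cond_false, hcb]
    · simp only [cond_true, LinearMap.id_apply, pow_succ', Module.End.mul_apply]
  · refine linearMap_ext_cycVec ω fun s j => ?_
    rw [LinearMap.comp_apply, LinearMap.comp_apply, hρ.apply_c, matC_cycVec, hT, hT]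
    cases s
    · simp only [cond_false, Bool.not_false, cond_true, LinearMap.id_apply, hr.c_apply_c]
    · simp only [cond_true, Bool.not_true, cond_false, LinearMap.id_apply]
  · intro h0
    have h1 := hT true 0
    rw [h0] at h1
    exact hv (by simpa using h1.symm)

end IsRho

/-- If `ζ ^ (2 ^ (n - k))` is an eigenvalue of `A`, then some eigenvector for it is moreover an
eigenvector of `B ^ (2 ^ (k - 2))`. -/
lemma exists_eigenvector_pow_b {V : Type*} [AddCommGroup V] [Module ℂ V] [FiniteDimensional ℂ V]
    {A B C : Module.End ℂ V} (h : HolRel n A B C) (hζ : IsPrimitiveRoot ζ (2 ^ n)) (hk : 2 ≤ k)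
    (hkn : k ≤ n) {u : V} (hu : u ≠ 0) (ha : A u = ζ ^ 2 ^ (n - k) • u) :
    ∃ v : V, v ≠ 0 ∧ A v = ζ ^ 2 ^ (n - k) • v ∧
      ∃ ω : ℂ, ω ^ 2 ^ (n - k) = 1 ∧ (B ^ 2 ^ (k - 2)) v = ω • v := by
  have hl := isPrimitiveRoot_pow_two_pow hζ hkn
  -- As `5 ^ 2 ^ (k - 2) = 1` modulo `2 ^ k`, this power of `B` preserves the eigenspace of `A`.
  have h5 : (ζ ^ 2 ^ (n - k)) ^ 5 ^ 2 ^ (k - 2) = ζ ^ 2 ^ (n - k) := by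
    conv_rhs => rw [← pow_one (ζ ^ 2 ^ (n - k))]
    rw [pow_eq_pow_iff_cast hl (by positivity)]
    push_cast
    exact five_pow_eq_one hk
  obtain ⟨v, hv, hv0, ω, hω⟩ := exists_eigenvector_mem (B ^ 2 ^ (k - 2))
    (Module.End.eigenspace A (ζ ^ 2 ^ (n - k))) (fun w hw => by
      rw [Module.End.mem_eigenspace_iff] at hw ⊢
      rw [h.apply_pow_b hw, h5]) (Module.End.mem_eigenspace_iff.2 ha) hu
  refine ⟨v, hv0, Module.End.mem_eigenspace_iff.1 hv, ω, ?_, hω⟩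
  refine eigenvalue_pow_eq_one hv0 hω ?_
  rw [← pow_mul, ← pow_add, show k - 2 + (n - k) = n - 2 by lia, h.pow_b]

end Monomial

/-! ### Properties invariant under equivalence -/

section Equivalence

variable {G V W : Type*} [Group G] [AddCommGroup V] [Module ℂ V] [AddCommGroup W] [Module ℂ W]
  {ρ : Representation ℂ G V} {σ : Representation ℂ G W}

lemma Equivalent.symm (h : Equivalent ρ σ) : Equivalent σ ρ :=
  h.map Representation.Equiv.symm

lemma Equivalent.trans {U : Type*} [AddCommGroup U] [Module ℂ U] {τ : Representation ℂ G U}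
    (h : Equivalent ρ σ) (h' : Equivalent σ τ) : Equivalent ρ τ :=
  h.elim fun e => h'.map e.trans

lemma Equivalent.finrank_eq (h : Equivalent ρ σ) : Module.finrank ℂ V = Module.finrank ℂ W :=
  h.elim fun e => e.toLinearEquiv.finrank_eq

lemma Equivalent.exists_linearEquiv (h : Equivalent ρ σ) :
    ∃ e : V ≃ₗ[ℂ] W, ∀ g v, e (ρ g v) = σ g (e v) :=
  h.elim fun e => ⟨e.toLinearEquiv,
    fun g v => Representation.IntertwiningMap.isIntertwining ρ σ e.toIntertwiningMap g v⟩

lemma Equivalent.isIrreducible (h : Equivalent ρ σ) (hρ : ρ.IsIrreducible) :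
    σ.IsIrreducible := by
  obtain ⟨e, he⟩ := h.exists_linearEquiv
  have := nontrivial_of_isIrreducible hρ
  have := e.symm.toEquiv.nontrivial
  refine isIrreducible_of_forall fun U hU hU0 => ?_
  obtain ⟨w, hw, hw0⟩ := U.exists_mem_ne_zero_of_ne_bot hU0
  have h1 : U.comap e.toLinearMap = ⊤ := by
    refine eq_top_of_isIrreducible hρ (fun g v hv => ?_) (v := e.symm w) (by simpa using hw)
      (by simpa using hw0)
    rw [Submodule.mem_comap] at hv ⊢
    exact (he g v).symm ▸ hU g _ hv
  rw [eq_top_iff]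
  intro x _
  have h2 : e.symm x ∈ U.comap e.toLinearMap := h1 ▸ Submodule.mem_top
  simpa using h2

lemma Equivalent.injective (h : Equivalent ρ σ) (hρ : Function.Injective ρ) :
    Function.Injective σ := by
  obtain ⟨e, he⟩ := h.exists_linearEquiv
  intro g g' hg
  refine hρ (LinearMap.ext fun v => e.injective ?_)
  rw [he, he, hg]

lemma Equivalent.belongsTo {n : ℕ} {ρ : Representation ℂ (Hol (Cyc n)) V}
    {σ : Representation ℂ (Hol (Cyc n)) W} (h : Equivalent ρ σ) {O : Set (Cyc n →* ℂˣ)}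
    (hρ : BelongsTo ρ O) : BelongsTo σ O := by
  obtain ⟨e, he⟩ := h.exists_linearEquiv
  obtain ⟨ψ, hψ, v, hv, hx⟩ := hρ
  exact ⟨ψ, hψ, e v, by simpa using hv, fun x => by rw [← he, hx, map_smul]⟩

end Equivalence

/-! ### Equivalence classes and their representatives -/

section Classes

variable {G V W : Type*} [Group G] [AddCommGroup V] [Module ℂ V] [AddCommGroup W] [Module ℂ W]
  {ρ : Representation ℂ G V} {σ : Representation ℂ G W} {κ κ' : IrrClass G}

/-- Classes are built from representations on `Fin d → ℂ` only; a choice of basis transports `ρ`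
there. -/
lemma exists_contains [FiniteDimensional ℂ V] (hρ : ρ.IsIrreducible) :
    ∃ κ : IrrClass G, κ.Contains ρ := by
  let e : V ≃ₗ[ℂ] (Fin (Module.finrank ℂ V) → ℂ) := (Module.finBasis ℂ V).equivFun
  let τ : Representation ℂ G (Fin (Module.finrank ℂ V) → ℂ) :=
    { toFun g := e.conj (ρ g)
      map_one' := by ext; simp [LinearEquiv.conj_apply]
      map_mul' g h := by ext; simp [LinearEquiv.conj_apply] }
  have h : Equivalent ρ τ := ⟨Representation.Equiv.mk e fun g => by
    ext v
    simp [τ, LinearEquiv.conj_apply]⟩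
  exact ⟨Quotient.mk _ ⟨_, τ, h.isIrreducible hρ⟩, ⟨_, τ, h.isIrreducible hρ⟩, rfl, h.symm⟩

lemma IrrClass.exists_rep (κ : IrrClass G) : ∃ σ : Irrep G, κ.Contains σ.rep := by
  obtain ⟨σ, rfl⟩ := Quotient.exists_rep κ
  exact ⟨σ, σ, rfl, ⟨Representation.Equiv.refl _⟩⟩

lemma IrrClass.Contains.eq_iff (h : κ.Contains ρ) (h' : κ'.Contains σ) :
    κ = κ' ↔ Equivalent ρ σ := by
  obtain ⟨τ, rfl, hτ⟩ := h
  obtain ⟨τ', rfl, hτ'⟩ := h'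
  refine ⟨fun h => ?_, fun h => Quotient.sound (s := irrepSetoid G) ?_⟩
  · have h1 : Equivalent τ.rep τ'.rep := Quotient.exact (s := irrepSetoid G) h
    exact hτ.symm.trans (h1.trans hτ')
  · exact hτ.trans (h.trans hτ'.symm)

lemma IrrClass.Contains.contains_iff (h : κ.Contains ρ) : κ.Contains σ ↔ Equivalent ρ σ := by
  refine ⟨fun h' => (h.eq_iff h').1 rfl, fun e => ?_⟩
  obtain ⟨τ, rfl, hτ⟩ := h
  exact ⟨τ, rfl, hτ.trans e⟩

lemma IrrClass.Contains.degree_eq (h : κ.Contains ρ) : κ.degree = Module.finrank ℂ V := by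
  obtain ⟨τ, rfl, hτ⟩ := h
  rw [← hτ.finrank_eq, Module.finrank_fin_fun]
  rfl

lemma IrrClass.Contains.belongsTo_iff {n : ℕ} {κ : IrrClass (Hol (Cyc n))}
    {ρ : Representation ℂ (Hol (Cyc n)) V} (h : κ.Contains ρ) {O : Set (Cyc n →* ℂˣ)} :
    κ.BelongsTo O ↔ HolTwo.BelongsTo ρ O := by
  constructor
  · rintro ⟨τ, hτ, hO⟩
    have : κ.Contains τ.rep := ⟨τ, hτ, ⟨Representation.Equiv.refl _⟩⟩
    exact ((this.eq_iff h).1 rfl).belongsTo hO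
  · intro hO
    obtain ⟨τ, hτ, e⟩ := h
    exact ⟨τ, hτ, e.symm.belongsTo hO⟩

/-- Classes with a given property are counted by a complete irredundant family. -/
lemma card_irrClass {I : Type*} {ρ : I → Representation ℂ G V} {κ : I → IrrClass G}
    (hκ : ∀ i, (κ i).Contains (ρ i)) (hinj : ∀ i j, Equivalent (ρ i) (ρ j) → i = j)
    {p : IrrClass G → Prop} (hp : ∀ i, p (κ i))
    (hsurj : ∀ (c : IrrClass G) (σ : Irrep G), c.Contains σ.rep → p c →
      ∃ i, Equivalent σ.rep (ρ i)) :
    Nat.card {c : IrrClass G // p c} = Nat.card I := by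
  refine (Nat.card_eq_of_bijective (fun i => (⟨κ i, hp i⟩ : {c // p c})) ⟨?_, ?_⟩).symm
  · intro i j h
    exact hinj i j (((hκ i).eq_iff (hκ j)).1 (congrArg Subtype.val h))
  · rintro ⟨c, hc⟩
    obtain ⟨σ, hσ⟩ := c.exists_rep
    obtain ⟨i, hi⟩ := hsurj c σ hσ hc
    exact ⟨i, Subtype.ext (((hκ i).eq_iff hσ).2 hi.symm)⟩

end Classes

/-! ### Orbits of characters, and faithfulness -/

section Orbits

variable {n k : ℕ} {ζ : ℂ} {V : Type*} [AddCommGroup V] [Module ℂ V]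

lemma exists_char_gen {z : ℂ} (hz : z ^ 2 ^ n = 1) :
    ∃ χ : Cyc n →* ℂˣ, (χ (gen n) : ℂ) = z := by
  let u : ℂˣ := Units.ofPowEqOne z _ hz (by positivity)
  have hu : u ^ 2 ^ n = 1 := Units.ext (by simp [u])
  let f : ℤ →+ Additive ℂˣ := zmultiplesHom _ (Additive.ofMul u)
  have hf : f ((2 ^ n : ℕ) : ℤ) = 0 := by
    simp only [f, zmultiplesHom_apply, natCast_zsmul, ← ofMul_pow, hu]
    rfl
  let F : ZMod (2 ^ n) →+ Additive ℂˣ := ZMod.lift (2 ^ n) ⟨f, hf⟩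
  refine ⟨AddMonoidHom.toMultiplicativeLeft F, ?_⟩
  have h1 : F 1 = Additive.ofMul u := by
    have := ZMod.lift_coe (2 ^ n) ⟨f, hf⟩ 1
    simpa [F, f] using this
  change ((Additive.toMul (F 1) : ℂˣ) : ℂ) = z
  rw [h1]
  rfl

/-- Applying `σ g⁻¹` turns a vector with character `χ ^ g` into one with character `χ`, so only the
base point of the orbit matters, and `χ` is determined by its value at the generator. -/
lemma belongsTo_orbit_iff (hζ : IsPrimitiveRoot ζ (2 ^ n))
    (σ : Representation ℂ (Hol (Cyc n)) V) :
    BelongsTo σ (orbit n ζ k) ↔ ∃ v : V, v ≠ 0 ∧ σ (genA n) v = ζ ^ 2 ^ (n - k) • v := by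
  constructor
  · rintro ⟨ψ, ⟨χ, hχ, g, rfl⟩, v, hv, h⟩
    refine ⟨σ g⁻¹ v, fun h0 => hv ?_, ?_⟩
    · have := congrArg (σ g) h0
      rwa [← Module.End.mul_apply, ← map_mul, mul_inv_cancel, map_one, Module.End.one_apply,
        map_zero] at this
    · have h1 : genA n * g⁻¹ = g⁻¹ * SemidirectProduct.inl (g.right (gen n)) := by
        have := inl_conj g (g.right (gen n))
        rw [MulAut.inv_apply_self] at this
        rw [genA, this]
        group
      rw [← Module.End.mul_apply, ← map_mul, h1, map_mul, Module.End.mul_apply, h, map_smul]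
      congr 1
      rw [← hχ]
      simp [conjChar]
  · rintro ⟨v, hv, h⟩
    obtain ⟨χ, hχ⟩ := exists_char_gen (n := n) (z := ζ ^ 2 ^ (n - k))
      (by rw [← pow_mul, mul_comm, pow_mul, hζ.pow_eq_one, one_pow])
    refine ⟨χ, ⟨χ, hχ, 1, ?_⟩, v, hv, fun x => ?_⟩
    · ext x
      simp [conjChar]
    · obtain ⟨i, rfl⟩ := exists_gen_pow x
      rw [← genA_pow, map_pow, pow_apply_of_eigen h, map_pow, Units.val_pow_eq_pow_val, hχ]

/-- A representation of the holomorph with an eigenvector of `a` belonging to a primitive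
`2 ^ n`-th root of unity is faithful. -/
lemma injective_of_eigenvector (hζ : IsPrimitiveRoot ζ (2 ^ n))
    (σ : Representation ℂ (Hol (Cyc n)) V) {v : V} (hv : v ≠ 0)
    (h : σ (genA n) v = ζ • v) : Function.Injective σ := by
  have hN (x : Cyc n) (hx : σ (SemidirectProduct.inl x) v = v) : x = 1 := by
    obtain ⟨i, rfl⟩ := exists_gen_pow x
    rw [← genA_pow, map_pow, pow_apply_of_eigen h] at hx
    rw [gen_pow_eq_one_iff]
    refine (hζ.pow_eq_one_iff_dvd i).1 (smul_left_injective ℂ hv ?_)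
    simpa using hx
  have hker (g : Hol (Cyc n)) (hg : σ g = 1) : g = 1 := by
    have hg' : σ g⁻¹ = 1 := by
      have := map_mul σ g⁻¹ g
      rw [inv_mul_cancel, hg, mul_one, map_one] at this
      exact this.symm
    -- For `g` in the kernel, `g⁻¹ * a * g * a⁻¹` lies in the cyclic subgroup and acts trivially,
    -- hence is `1`. So `g` centralises `a` and its automorphism part is trivial.
    have hr : g.right⁻¹ = 1 := by
      apply mulAut_ext
      have h1 : SemidirectProduct.inl (g.right⁻¹ (gen n) * (gen n)⁻¹) =
          g⁻¹ * genA n * g * (genA n)⁻¹ := by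
        rw [map_mul, inl_conj, map_inv, genA]
      have h2 := hN (g.right⁻¹ (gen n) * (gen n)⁻¹) (by
        rw [h1, map_mul, map_mul, map_mul, hg, hg', one_mul, mul_one, ← map_mul,
          mul_inv_cancel, map_one, Module.End.one_apply])
      rw [MulAut.one_apply]
      exact mul_inv_eq_one.1 h2
    have h3 : g = SemidirectProduct.inl g.left := by
      conv_lhs => rw [← SemidirectProduct.inl_left_mul_inr_right g, inv_eq_one.1 hr, map_one,
        mul_one]
    rw [h3, hN g.left (by rw [← h3, hg, Module.End.one_apply]), map_one]
  intro g g' hgg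
  refine inv_mul_eq_one.1 (hker (g⁻¹ * g') ?_)
  rw [map_mul, ← hgg, ← map_mul, inv_mul_cancel, map_one]

end Orbits

/-! ### Classification and counting -/

section Classification

variable {n : ℕ} {ζ : ℂ}

/-- A family of linear representations indexed by the values on the generators. -/
def IsLinFamily (n : ℕ)
    (lin : Fin 2 → rootsOfUnity (2 ^ (n - 2)) ℂ → ℤˣ → Representation ℂ (Hol (Cyc n)) ℂ) :
    Prop :=
  ∀ (i : Fin 2) (ω : rootsOfUnity (2 ^ (n - 2)) ℂ) (ε : ℤˣ),
    IsLin n ((-1 : ℂ) ^ (i : ℕ)) ((ω : ℂˣ) : ℂ) ((ε : ℤ) : ℂ) (lin i ω ε)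

/-- A family of monomial representations indexed by the roots of unity. -/
def IsRhoFamily (n : ℕ) (ζ : ℂ) (rho : (k : ℕ) → rootsOfUnity (2 ^ (n - k)) ℂ →
    Representation ℂ (Hol (Cyc n)) (Ix k → ℂ)) : Prop :=
  ∀ k, 2 ≤ k → k ≤ n → ∀ ω : rootsOfUnity (2 ^ (n - k)) ℂ, IsRho n k ζ ((ω : ℂˣ) : ℂ) (rho k ω)

lemma rootsOfUnity_val_pow {m : ℕ} (ω : rootsOfUnity m ℂ) : ((ω : ℂˣ) : ℂ) ^ m = 1 := by
  have := (mem_rootsOfUnity m (ω : ℂˣ)).1 ω.2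
  simpa using congrArg Units.val this

lemma exists_rootsOfUnity {m : ℕ} (hm : m ≠ 0) {z : ℂ} (hz : z ^ m = 1) :
    ∃ ω : rootsOfUnity m ℂ, ((ω : ℂˣ) : ℂ) = z := by
  refine ⟨⟨Units.ofPowEqOne z m hz hm, ?_⟩, rfl⟩
  rw [mem_rootsOfUnity]
  exact Units.ext (by simp)

lemma exists_isLinFamily (hn : 2 ≤ n) : ∃ lin, IsLinFamily n lin := by
  have h (i : Fin 2) (ω : rootsOfUnity (2 ^ (n - 2)) ℂ) (ε : ℤˣ) :
      ∃ ρ, IsLin n ((-1 : ℂ) ^ (i : ℕ)) ((ω : ℂˣ) : ℂ) ((ε : ℤ) : ℂ) ρ := by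
    refine exists_isLin hn ?_ (rootsOfUnity_val_pow ω) ?_
    · rw [← pow_mul, mul_comm, pow_mul]
      simp
    · rcases Int.units_eq_one_or ε with rfl | rfl <;> simp
  choose lin hlin using h
  exact ⟨lin, hlin⟩

lemma exists_isRhoFamily (hζ : IsPrimitiveRoot ζ (2 ^ n)) : ∃ rho, IsRhoFamily n ζ rho := by
  have h (k : ℕ) (ω : rootsOfUnity (2 ^ (n - k)) ℂ) :
      ∃ ρ, 2 ≤ k → k ≤ n → IsRho n k ζ ((ω : ℂˣ) : ℂ) ρ := by
    by_cases hk : 2 ≤ k ∧ k ≤ n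
    · obtain ⟨ρ, hρ⟩ := exists_isRho hζ hk.1 hk.2 (rootsOfUnity_val_pow ω)
      exact ⟨ρ, fun _ _ => hρ⟩
    -- Outside `2 ≤ k ≤ n` the trivial representation serves as a default value.
    · exact ⟨1, fun h1 h2 => absurd ⟨h1, h2⟩ hk⟩
  choose rho hrho using h
  exact ⟨rho, fun k h1 h2 ω => hrho k ω h1 h2⟩

lemma totient_two_pow {k : ℕ} (hk : 1 ≤ k) : Nat.totient (2 ^ k) = 2 ^ (k - 1) := by
  rw [Nat.totient_prime_pow Nat.prime_two hk]
  simp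

lemma finrank_ix {k : ℕ} (hk : 2 ≤ k) : Module.finrank ℂ (Ix k → ℂ) = 2 ^ (k - 1) := by
  rw [Module.finrank_fintype_fun_eq_card, Fintype.card_sum, Fintype.card_fin, ← two_mul,
    ← pow_succ']
  congr 1
  lia

lemma card_rootsOfUnity_complex (m : ℕ) [NeZero m] : Nat.card (rootsOfUnity m ℂ) = m := by
  rw [Complex.card_rootsOfUnity]

variable {lin : Fin 2 → rootsOfUnity (2 ^ (n - 2)) ℂ → ℤˣ → Representation ℂ (Hol (Cyc n)) ℂ}
  {rho : (k : ℕ) → rootsOfUnity (2 ^ (n - k)) ℂ → Representation ℂ (Hol (Cyc n)) (Ix k → ℂ)}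

lemma IsLinFamily.inj (hlin : IsLinFamily n lin) {i i' : Fin 2}
    {ω ω' : rootsOfUnity (2 ^ (n - 2)) ℂ} {ε ε' : ℤˣ}
    (h : Equivalent (lin i ω ε) (lin i' ω' ε')) : i = i' ∧ ω = ω' ∧ ε = ε' := by
  obtain ⟨h1, h2, h3⟩ := (hlin i ω ε).eq_of_equivalent (hlin i' ω' ε') h
  refine ⟨?_, Subtype.ext (Units.ext h2), Units.ext (by exact_mod_cast h3)⟩
  fin_cases i <;> fin_cases i' <;> first | rfl | norm_num at h1

lemma IsRhoFamily.inj (hrho : IsRhoFamily n ζ rho) {k : ℕ} (hk : 2 ≤ k) (hkn : k ≤ n)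
    {ω ω' : rootsOfUnity (2 ^ (n - k)) ℂ} (h : Equivalent (rho k ω) (rho k ω')) : ω = ω' :=
  Subtype.ext (Units.ext ((hrho k hk hkn ω).eq_of_equivalent (hrho k hk hkn ω') h))

lemma IsRhoFamily.isIrreducible (hrho : IsRhoFamily n ζ rho) (hζ : IsPrimitiveRoot ζ (2 ^ n))
    {k : ℕ} (hk : 2 ≤ k) (hkn : k ≤ n) (ω : rootsOfUnity (2 ^ (n - k)) ℂ) :
    (rho k ω).IsIrreducible :=
  (hrho k hk hkn ω).isIrreducible hζ hk hkn (Units.ne_zero _)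

lemma IsRhoFamily.belongsTo (hrho : IsRhoFamily n ζ rho) (hζ : IsPrimitiveRoot ζ (2 ^ n))
    {k : ℕ} (hk : 2 ≤ k) (hkn : k ≤ n) (ω : rootsOfUnity (2 ^ (n - k)) ℂ) :
    BelongsTo (rho k ω) (orbit n ζ k) :=
  (belongsTo_orbit_iff hζ _).2
    ⟨_, cycVec_zero_ne_zero (ω := ((ω : ℂˣ) : ℂ)), (hrho k hk hkn ω).apply_a_cycVec hζ hk hkn⟩

variable {V : Type*} [AddCommGroup V] [Module ℂ V] {σ : Representation ℂ (Hol (Cyc n)) V}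

lemma IsLinFamily.exists_equivalent (hlin : IsLinFamily n lin) (hn : 2 ≤ n)
    (hσ : σ.IsIrreducible) {v : V} (hv : v ≠ 0) {α β γ : ℂ} (ha : σ (genA n) v = α • v)
    (hb : σ (genB n) v = β • v) (hc : σ (genC n) v = γ • v) :
    ∃ i ω ε, Equivalent σ (lin i ω ε) := by
  obtain ⟨hα, hβ, hγ⟩ := ((holRel hn).map σ).scalar_relations hv ha hb hc
  obtain ⟨i, hi⟩ : ∃ i : Fin 2, (-1 : ℂ) ^ (i : ℕ) = α := by
    rcases sq_eq_one_iff.1 hα with rfl | rfl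
    · exact ⟨0, by simp⟩
    · exact ⟨1, by simp⟩
  obtain ⟨ω, rfl⟩ := exists_rootsOfUnity (by positivity) hβ
  obtain ⟨ε, hε⟩ : ∃ ε : ℤˣ, ((ε : ℤ) : ℂ) = γ := by
    rcases sq_eq_one_iff.1 hγ with rfl | rfl
    · exact ⟨1, by simp⟩
    · exact ⟨-1, by simp⟩
  subst hi hε
  exact ⟨i, ω, ε, (hlin i ω ε).equivalent hn hσ hv ha hb hc⟩

lemma IsLinFamily.exists_equivalent_of_finrank (hlin : IsLinFamily n lin) (hn : 2 ≤ n)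
    (σ : Representation ℂ (Hol (Cyc n)) V) (h : Module.finrank ℂ V = 1) :
    ∃ i ω ε, Equivalent σ (lin i ω ε) := by
  obtain ⟨v, hv, hspan⟩ := finrank_eq_one_iff'.1 h
  obtain ⟨α, hα⟩ := hspan (σ (genA n) v)
  obtain ⟨β, hβ⟩ := hspan (σ (genB n) v)
  obtain ⟨γ, hγ⟩ := hspan (σ (genC n) v)
  exact hlin.exists_equivalent hn (isIrreducible_of_finrank_eq_one σ h) hv hα.symm hβ.symm hγ.symm

lemma IsRhoFamily.exists_equivalent (hrho : IsRhoFamily n ζ rho)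
    (hζ : IsPrimitiveRoot ζ (2 ^ n)) {k : ℕ} (hk : 2 ≤ k) (hkn : k ≤ n)
    (hσ : σ.IsIrreducible) {u : V} (hu : u ≠ 0) (ha : σ (genA n) u = ζ ^ 2 ^ (n - k) • u) :
    ∃ ω, Equivalent σ (rho k ω) := by
  have := finiteDimensional_of_isIrreducible hσ
  obtain ⟨v, hv, hav, ω, hω, hb⟩ :=
    exists_eigenvector_pow_b ((holRel (hk.trans hkn)).map σ) hζ hk hkn hu ha
  obtain ⟨ω, rfl⟩ := exists_rootsOfUnity (by positivity) hω
  exact ⟨ω, (hrho k hk hkn ω).equivalent hζ hk hkn (Units.ne_zero _) hσ hv hav hb⟩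

lemma classification (hlin : IsLinFamily n lin) (hrho : IsRhoFamily n ζ rho) (hn : 2 ≤ n)
    (hζ : IsPrimitiveRoot ζ (2 ^ n)) (hσ : σ.IsIrreducible) :
    (∃ i ω ε, Equivalent σ (lin i ω ε)) ∨
      ∃ k, 2 ≤ k ∧ k ≤ n ∧ ∃ ω, Equivalent σ (rho k ω) := by
  have := finiteDimensional_of_isIrreducible hσ
  have := nontrivial_of_isIrreducible hσ
  rcases ((holRel hn).map σ).exists_eigenvector hζ with
    ⟨v, hv, α, β, γ, ha, hb, hc⟩ | ⟨k, hk, hkn, v, hv, ha⟩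
  · exact Or.inl (hlin.exists_equivalent hn hσ hv ha hb hc)
  · exact Or.inr ⟨k, hk, hkn, hrho.exists_equivalent hζ hk hkn hσ hv ha⟩

lemma card_degree_one (hlin : IsLinFamily n lin) (hn : 2 ≤ n) :
    Nat.card {κ : IrrClass (Hol (Cyc n)) // κ.degree = 1} = 2 ^ n := by
  have h (x : Fin 2 × rootsOfUnity (2 ^ (n - 2)) ℂ × ℤˣ) :=
    exists_contains (hlin x.1 x.2.1 x.2.2).isIrreducible
  choose κ hκ using h
  rw [card_irrClass hκ]
  · rw [Nat.card_prod, Nat.card_prod, card_rootsOfUnity_complex, Nat.card_eq_fintype_card,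
      Nat.card_eq_fintype_card, Fintype.card_fin, Fintype.card_units_int, ← pow_succ, ← pow_succ']
    congr 1
    lia
  · rintro ⟨i, ω, ε⟩ ⟨i', ω', ε'⟩ e
    obtain ⟨rfl, rfl, rfl⟩ := hlin.inj e
    rfl
  · intro x
    rw [(hκ x).degree_eq, Module.finrank_self]
  · intro c σ hc h1
    obtain ⟨i, ω, ε, e⟩ :=
      hlin.exists_equivalent_of_finrank hn σ.rep (hc.degree_eq.symm.trans h1)
    exact ⟨⟨i, ω, ε⟩, e⟩

lemma card_belongsTo (hrho : IsRhoFamily n ζ rho) (hζ : IsPrimitiveRoot ζ (2 ^ n)) {k : ℕ}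
    (hk : 2 ≤ k) (hkn : k ≤ n) :
    Nat.card {κ : IrrClass (Hol (Cyc n)) // κ.BelongsTo (orbit n ζ k)} = 2 ^ (n - k) := by
  choose κ hκ using fun ω => exists_contains (hrho.isIrreducible hζ hk hkn ω)
  rw [card_irrClass hκ, card_rootsOfUnity_complex]
  · exact fun ω ω' e => hrho.inj hk hkn e
  · exact fun ω => (hκ ω).belongsTo_iff.2 (hrho.belongsTo hζ hk hkn ω)
  · intro c σ hc hO
    obtain ⟨v, hv, h⟩ := (belongsTo_orbit_iff hζ _).1 (hc.belongsTo_iff.1 hO)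
    exact hrho.exists_equivalent hζ hk hkn σ.irreducible hv h

/-- The degree `2 ^ (k - 1)` determines `k`, and it is not `1` because `2 ≤ k`. -/
lemma card_degree_eq (hlin : IsLinFamily n lin) (hrho : IsRhoFamily n ζ rho)
    (hζ : IsPrimitiveRoot ζ (2 ^ n)) {k : ℕ} (hk : 2 ≤ k) (hkn : k ≤ n) :
    Nat.card {κ : IrrClass (Hol (Cyc n)) // κ.degree = Nat.totient (2 ^ k)} = 2 ^ (n - k) := by
  choose κ hκ using fun ω => exists_contains (hrho.isIrreducible hζ hk hkn ω)
  rw [totient_two_pow (by lia), card_irrClass hκ, card_rootsOfUnity_complex]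
  · exact fun ω ω' e => hrho.inj hk hkn e
  · intro ω
    rw [(hκ ω).degree_eq, finrank_ix hk]
  · intro c σ hc hd
    rw [hc.degree_eq] at hd
    rcases classification hlin hrho (hk.trans hkn) hζ σ.irreducible with
      ⟨i, ω, ε, e⟩ | ⟨k', hk', hkn', ω, e⟩
    · rw [e.finrank_eq, Module.finrank_self, eq_comm, Nat.pow_eq_one] at hd
      lia
    · rw [e.finrank_eq, finrank_ix hk'] at hd
      have := Nat.pow_right_injective le_rfl hd
      obtain rfl : k' = k := by lia
      exact ⟨ω, e⟩

/-- Classes are sorted by degree: `2 ^ n` of degree one and `2 ^ (n - k)` for each `k` from `2` to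
`n`. The latter add up to `1 + 2 + ⋯ + 2 ^ (n - 2)`, so exactly the term `2 ^ (n - 1)` is missing.
-/
lemma card_irrClass_hol (hlin : IsLinFamily n lin) (hrho : IsRhoFamily n ζ rho) (hn : 2 ≤ n)
    (hζ : IsPrimitiveRoot ζ (2 ^ n)) : Nat.card (IrrClass (Hol (Cyc n))) =
      (∑ i ∈ Finset.range (n + 1), 2 ^ i) - 2 ^ (n - 1) := by
  have hdeg (κ : IrrClass (Hol (Cyc n))) :
      κ.degree = 1 ∨ ∃ i : Fin (n - 1), κ.degree = 2 ^ ((i : ℕ) + 1) := by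
    obtain ⟨σ, hσ⟩ := κ.exists_rep
    rw [hσ.degree_eq]
    rcases classification hlin hrho hn hζ σ.irreducible with ⟨i, ω, ε, e⟩ | ⟨k, hk, hkn, ω, e⟩
    · exact Or.inl (e.finrank_eq.trans (Module.finrank_self ℂ))
    · refine Or.inr ⟨⟨k - 2, by lia⟩, ?_⟩
      rw [e.finrank_eq, finrank_ix hk]
      congr 1
      simp only
      lia
  have hne (i : ℕ) : (2 : ℕ) ^ (i + 1) ≠ 1 := by simp
  -- Here `none` labels degree one, and `some i` the degree belonging to `k = i + 2`.
  let d : Option (Fin (n - 1)) → ℕ := fun o => o.elim 1 fun i => 2 ^ ((i : ℕ) + 1)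
  have hd : Function.Injective d := by
    rintro (_ | i) (_ | j) h
    · rfl
    · exact absurd h.symm (hne _)
    · exact absurd h (hne _)
    · have := Nat.pow_right_injective le_rfl h
      exact congrArg some (Fin.ext (by simpa using this))
  have hex (κ : IrrClass (Hol (Cyc n))) : ∃ o, κ.degree = d o := by
    rcases hdeg κ with h | ⟨i, h⟩
    · exact ⟨none, h⟩
    · exact ⟨some i, h⟩
  choose o ho using hex
  have hcard (x : Option (Fin (n - 1))) : Nat.card {κ // o κ = x} =
      x.elim (2 ^ n) fun i => 2 ^ (n - (i + 2)) := by
    have hiff (κ : IrrClass (Hol (Cyc n))) : o κ = x ↔ κ.degree = d x := by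
      rw [ho, hd.eq_iff]
    rw [Nat.card_congr (Equiv.subtypeEquivRight hiff)]
    rcases x with _ | i
    · exact card_degree_one hlin hn
    · have := card_degree_eq hlin hrho hζ (k := i + 2) (by lia) (by lia)
      rwa [totient_two_pow (by lia)] at this
  have hfin (x : Option (Fin (n - 1))) : Finite {κ // o κ = x} := by
    refine Nat.finite_of_card_ne_zero ?_
    rw [hcard]
    rcases x with _ | i <;> simp
  rw [Nat.card_congr (Equiv.sigmaFiberEquiv o).symm, Nat.card_sigma]
  simp only [hcard, Fintype.sum_option, Option.elim]
  rw [Fin.sum_univ_eq_sum_range (fun i => 2 ^ (n - (i + 2))) (n - 1)]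
  have h1 : ∑ i ∈ Finset.range (n - 1), 2 ^ (n - (i + 2)) =
      ∑ i ∈ Finset.range (n - 1), 2 ^ i := by
    rw [← Finset.sum_range_reflect]
    refine Finset.sum_congr rfl fun i hi => ?_
    rw [Finset.mem_range] at hi
    congr 1
    lia
  rw [h1, Finset.sum_range_succ, show n = (n - 1) + 1 by lia, Finset.sum_range_succ]
  simp only [Nat.add_sub_cancel]
  lia

/-- The element `a ^ 2` acts trivially but is not `1`. -/
lemma not_injective_lin (hlin : IsLinFamily n lin) (hn : 2 ≤ n) (i : Fin 2)
    (ω : rootsOfUnity (2 ^ (n - 2)) ℂ) (ε : ℤˣ) : ¬ Function.Injective (lin i ω ε) := by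
  intro h
  have h1 : genA n ^ 2 = 1 := by
    apply h
    rw [map_pow, (hlin i ω ε).apply_a, map_one, smul_pow, ← pow_mul, mul_comm, pow_mul]
    simp
    rfl
  rw [genA_pow, ← map_one SemidirectProduct.inl, SemidirectProduct.inl_inj,
    gen_pow_eq_one_iff] at h1
  have := (Nat.pow_dvd_pow_iff_le_right (x := 2) (k := n) (l := 1) (by lia)).1 h1
  lia

lemma not_injective_rho (hrho : IsRhoFamily n ζ rho) (hζ : IsPrimitiveRoot ζ (2 ^ n)) {k : ℕ}
    (hk : 2 ≤ k) (hkn : k < n) (ω : rootsOfUnity (2 ^ (n - k)) ℂ) :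
    ¬ Function.Injective (rho k ω) := by
  intro h
  have h1 : genA n ^ 2 ^ k = 1 := by
    apply h
    rw [(hrho k hk hkn.le ω).apply_pow_a hζ hk hkn.le, map_one]
  rw [genA_pow, ← map_one SemidirectProduct.inl, SemidirectProduct.inl_inj,
    gen_pow_eq_one_iff] at h1
  have := (Nat.pow_dvd_pow_iff_le_right (x := 2) (k := n) (l := k) (by lia)).1 h1
  lia

lemma injective_rho (hrho : IsRhoFamily n ζ rho) (hζ : IsPrimitiveRoot ζ (2 ^ n)) (hn : 2 ≤ n)
    (ω : rootsOfUnity (2 ^ (n - n)) ℂ) : Function.Injective (rho n ω) := by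
  refine injective_of_eigenvector hζ _ cycVec_zero_ne_zero ?_ (v := cycVec n ((ω : ℂˣ) : ℂ) true 0)
  simpa using (hrho n hn le_rfl ω).apply_a_cycVec hζ hn le_rfl

lemma eq_one_of_rootsOfUnity_sub_self (ω : rootsOfUnity (2 ^ (n - n)) ℂ) : ω = 1 := by
  apply Subtype.ext
  apply Units.ext
  simpa using rootsOfUnity_val_pow ω

end Classification

end HolTwo

theorem theorem9p1p1 (n : ℕ) (hn : 3 ≤ n) (ζ : ℂ) (hζ : IsPrimitiveRoot ζ (2 ^ n)) :
    -- the presentation of the holomorph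
    (∃ e : PresentedGroup (relators n) ≃* Hol (Cyc n),
      e (PresentedGroup.of Gen.a) = genA n ∧
      e (PresentedGroup.of Gen.b) = genB n ∧
      e (PresentedGroup.of Gen.c) = genC n) ∧
    -- the explicit representations `lin i ω ε` of degree one and `rho k ω`
    ∃ (lin : Fin 2 → rootsOfUnity (2 ^ (n - 2)) ℂ → ℤˣ → Representation ℂ (Hol (Cyc n)) ℂ)
      (rho : (k : ℕ) → rootsOfUnity (2 ^ (n - k)) ℂ →
        Representation ℂ (Hol (Cyc n)) (Ix k → ℂ)),
      (∀ i ω ε,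
        lin i ω ε (genA n) = ((-1 : ℂ) ^ (i : ℕ)) • LinearMap.id ∧
        lin i ω ε (genB n) = ((ω : ℂˣ) : ℂ) • LinearMap.id ∧
        lin i ω ε (genC n) = ((ε : ℤ) : ℂ) • LinearMap.id) ∧
      (∀ k, 2 ≤ k → k ≤ n → ∀ ω,
        rho k ω (genA n) = Matrix.toLin' (matA n k ζ) ∧
        rho k ω (genB n) = Matrix.toLin' (matB k ((ω : ℂˣ) : ℂ)) ∧
        rho k ω (genC n) = Matrix.toLin' (matC k)) ∧
      -- 1. representations of degree one
      (Nat.card {κ : IrrClass (Hol (Cyc n)) // κ.degree = 1} = 2 * Nat.totient (2 ^ n) ∧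
        2 * Nat.totient (2 ^ n) = 2 ^ n ∧
        (∀ i ω ε i' ω' ε', Equivalent (lin i ω ε) (lin i' ω' ε') →
          i = i' ∧ ω = ω' ∧ ε = ε') ∧
        ∀ (V : Type u) [AddCommGroup V] [Module ℂ V] (σ : Representation ℂ (Hol (Cyc n)) V),
          Module.finrank ℂ V = 1 → ∃ i ω ε, Equivalent σ (lin i ω ε)) ∧
      -- 2. representations belonging to the orbit `O_k`, `2 ≤ k ≤ n`
      (∀ k, 2 ≤ k → k ≤ n →
        Nat.card {κ : IrrClass (Hol (Cyc n)) // κ.BelongsTo (orbit n ζ k)} = 2 ^ (n - k) ∧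
        Nat.card {κ : IrrClass (Hol (Cyc n)) // κ.degree = Nat.totient (2 ^ k)} = 2 ^ (n - k) ∧
        Nat.totient (2 ^ k) = 2 ^ (k - 1) ∧
        (∀ ω, (rho k ω).IsIrreducible ∧ BelongsTo (rho k ω) (orbit n ζ k) ∧
          Module.finrank ℂ (Ix k → ℂ) = Nat.totient (2 ^ k)) ∧
        (∀ ω ω', Equivalent (rho k ω) (rho k ω') → ω = ω') ∧
        ∀ (V : Type u) [AddCommGroup V] [Module ℂ V] (σ : Representation ℂ (Hol (Cyc n)) V),
          σ.IsIrreducible → BelongsTo σ (orbit n ζ k) → ∃ ω, Equivalent σ (rho k ω)) ∧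
      -- 3. the total number, and completeness of the list
      (Nat.card (IrrClass (Hol (Cyc n))) = (∑ i ∈ Finset.range (n + 1), 2 ^ i) - 2 ^ (n - 1) ∧
        ∀ (V : Type u) [AddCommGroup V] [Module ℂ V] (σ : Representation ℂ (Hol (Cyc n)) V),
          σ.IsIrreducible →
            (∃ i ω ε, Equivalent σ (lin i ω ε)) ∨
            (∃ k, 2 ≤ k ∧ k ≤ n ∧ ∃ ω, Equivalent σ (rho k ω))) ∧
      -- 4. the orbit `O_n` and the unique faithful irreducible representation
      (∃ κ : IrrClass (Hol (Cyc n)),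
        (∀ κ' : IrrClass (Hol (Cyc n)), κ'.BelongsTo (orbit n ζ n) ↔ κ' = κ) ∧
        κ.degree = Nat.totient (2 ^ n) ∧
        κ.Contains (rho n 1) ∧
        Function.Injective (rho n 1) ∧
        ∀ (V : Type u) [AddCommGroup V] [Module ℂ V] (σ : Representation ℂ (Hol (Cyc n)) V),
          σ.IsIrreducible → (Function.Injective σ ↔ κ.Contains σ)) := by
  have hn2 : 2 ≤ n := by lia
  obtain ⟨lin, hlin⟩ := exists_isLinFamily hn2
  obtain ⟨rho, hrho⟩ := exists_isRhoFamily hζ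
  have htot : 2 * Nat.totient (2 ^ n) = 2 ^ n := by
    rw [totient_two_pow (by lia), ← pow_succ']
    congr 1
    lia
  refine ⟨⟨presentation hn2, presentation_of hn2 _, presentation_of hn2 _, presentation_of hn2 _⟩,
    lin, rho, fun i ω ε => ⟨(hlin i ω ε).1, (hlin i ω ε).2, (hlin i ω ε).3⟩,
    fun k hk hkn ω => ⟨(hrho k hk hkn ω).1, (hrho k hk hkn ω).2, (hrho k hk hkn ω).3⟩,
    ⟨?_, htot, fun i ω ε i' ω' ε' e => hlin.inj e,
      fun V _ _ σ h => hlin.exists_equivalent_of_finrank hn2 σ h⟩,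
    fun k hk hkn => ⟨card_belongsTo hrho hζ hk hkn, card_degree_eq hlin hrho hζ hk hkn,
      totient_two_pow (by lia), fun ω => ⟨hrho.isIrreducible hζ hk hkn ω,
        hrho.belongsTo hζ hk hkn ω, ?_⟩, fun ω ω' e => hrho.inj hk hkn e, ?_⟩,
    ⟨card_irrClass_hol hlin hrho hn2 hζ, fun V _ _ σ hσ => classification hlin hrho hn2 hζ hσ⟩, ?_⟩
  · rw [card_degree_one hlin hn2, htot]
  · rw [finrank_ix hk, totient_two_pow (by lia)]
  · intro V _ _ σ hσ hO
    obtain ⟨v, hv, h⟩ := (belongsTo_orbit_iff hζ _).1 hO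
    exact hrho.exists_equivalent hζ hk hkn hσ hv h
  · have hirr := hrho.isIrreducible hζ hn2 le_rfl 1
    obtain ⟨κ, hκ⟩ := exists_contains hirr
    refine ⟨κ, fun κ' => ?_, ?_, hκ, injective_rho hrho hζ hn2 1, fun V _ _ σ hσ => ?_⟩
    · obtain ⟨σ, hσ⟩ := κ'.exists_rep
      rw [hσ.belongsTo_iff, hσ.eq_iff hκ]
      refine ⟨fun hO => ?_, fun e => e.symm.belongsTo (hrho.belongsTo hζ hn2 le_rfl 1)⟩
      obtain ⟨v, hv, h⟩ := (belongsTo_orbit_iff hζ _).1 hO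
      obtain ⟨ω, e⟩ := hrho.exists_equivalent hζ hn2 le_rfl σ.irreducible hv h
      rwa [eq_one_of_rootsOfUnity_sub_self ω] at e
    · rw [hκ.degree_eq, finrank_ix hn2, totient_two_pow (by lia)]
    · rw [hκ.contains_iff]
      refine ⟨fun h => ?_, fun e => e.injective (injective_rho hrho hζ hn2 1)⟩
      -- Degree one is excluded by `a ^ 2` and `k < n` by `a ^ 2 ^ k`; for `k = n` the only root is
      -- `ω = 1`.
      rcases classification hlin hrho hn2 hζ hσ with ⟨i, ω, ε, e⟩ | ⟨k, hk, hkn, ω, e⟩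
      · exact absurd (e.injective h) (not_injective_lin hlin hn2 i ω ε)
      · rcases hkn.lt_or_eq with hlt | rfl
        · exact absurd (e.injective h) (not_injective_rho hrho hζ hk hlt ω)
        · rw [eq_one_of_rootsOfUnity_sub_self ω] at e
          exact e.symm
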